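/- Fix an integer $k\ge 1$. For $n=k\cdot n'$, sample $m=m(n)$ points $z_1,\dots,z_m$ (the path-nodes) and, for each tier $l=1,\dots,k$, $n'=n/k$ points $y^l_1,\dots,y^l_{n'}$ (the node-nodes), all independent and uniform on $[0,1]$. The random auxiliary graph $G'$ is the bipartite graph on these $m+n$ vertices in which each path-node $z_j$ is joined, in each tier $l$, to exactly one node-node: the one closest to $z_j$ among $y^l_1,\dots,y^l_{n'}$. Suppose $m=\omega(n)$, i.e. $m/n\to\infty$ as $n\to\infty$. "With high probability" (whp) means with probability tending to $1$ as $n\to\infty$. (1) There is a sequence $\delta_n\to 0$ such that whp the treewidth satisfies $$tw(G')\le k\cdot\frac{m}{n}\cdot\log n\cdot(1+\delta_n).$$ Now equip $G'$ with a linear threshold process. Path-nodes have threshold $k-1$ and may not be seeded. Node-node $a$ has a threshold $c_a\in\mathbb N_0$. Every edge has weight $1$ towards its path-node and an arbitrary weight in $\mathbb N_0$ towards its node-node. A vertex that is not active becomes active when the total weight of the edges it receives from active neighbours is at least its threshold. The task is to find a smallest set of node-nodes whose activation eventually activates all of $G'$. Consider the following algorithm for this task, with steps counted on a unit-cost basis.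 (i) Find a nice tree decomposition of $G'$ of minimum width, i.e. a rooted one in which all bags have the same size $\omega=tw(G')+1$ and each node is a leaf, a replace node (one child, whose bag differs by the exchange of one vertex) or a join node (two children with the same bag). For $w=1,2,\dots$ this is done by tabulating, over all ordered bags $X$ of $w$ vertices and all components $C$ of $G'-X$, whether $G'[X\cup C]$ has such a decomposition with root bag $X$ and all bags of size $w$. (ii) From the leaves to the root, compute for each node of the tree a table of smallest seed sets for the subgraph spanned by the bags at and below it, indexed by all threshold vectors in $\{0,\dots,c_{\max}\}^{\omega}$ and all activation-time vectors in $\{0,\dots,\omega\}^{\omega}$ on the bag, where $c_{\max}$ is the largest threshold in $G'$. Leaf entries are found by enumerating subsets of the bag. At a replace node one minimizes over the place of the removed vertex in the activation order and then inserts the edges of the new vertex one at a time. At a join node one minimizes over the splittings of the threshold vector between the two children. Read off a smallest seed set at the root. Let $M$ be any constant. Then: (2) if $m=o(n^2)$, the algorithm is subexponential: there is $g(n)=o(n)$ such that whp, for all choices of node-node thresholds $c_a\le M$ and of edge weights, it takes at most $2^{g(n)}$ steps; (3) if $m=o(n^{1+\varepsilon})$ for every $\varepsilon>0$, the algorithm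 is quasi-polynomial: there are constants $C,d$ such that whp, for all choices of node-node thresholds $c_a\le M$ and of edge weights, it takes at most $2^{C(\log n)^d}$ steps. -/

import Mathlib

open Filter Topology MeasureTheory Asymptotics

/-! ### Treewidth -/

/-- A tree decomposition of `G`: a tree `T` together with a bag `X z` of vertices for each node. -/
structure IsTreeDecomposition {V Z : Type} (G : SimpleGraph V) (T : SimpleGraph Z)
    (X : Z → Finset V) : Prop where
  isTree : T.IsTree
  cover : ∀ v, ∃ z, v ∈ X z
  edge : ∀ i j, G.Adj i j → ∃ z, i ∈ X z ∧ j ∈ X z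
  path : ∀ (x y z : Z) (p : T.Walk x y), p.IsPath → z ∈ p.support →
    ∀ v, v ∈ X x → v ∈ X y → v ∈ X z

/-- The treewidth of a finite graph: the least `w` such that some tree decomposition has all its
bags of size at most `w + 1`. -/
noncomputable def treewidth {V : Type} (G : SimpleGraph V) : ℕ :=
  sInf {w | ∃ (Z : Type) (_ : Finite Z) (T : SimpleGraph Z) (X : Z → Finset V),
    IsTreeDecomposition G T X ∧ ∀ z, (X z).card ≤ w + 1}

/-! ### Step counting -/

/-- The result of a computation together with the number of elementary steps it took. -/
structure Timed (α : Type) where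
  val : α
  time : ℕ

namespace Timed

instance : Monad Timed where
  pure a := ⟨a, 0⟩
  bind x f := ⟨(f x.val).val, x.time + (f x.val).time⟩

/-- Spend `c` elementary steps. -/
def tick (c : ℕ) : Timed Unit := ⟨(), c⟩

/-- Run `f` on every entry of a list, with one step of overhead per entry. -/
def each {α β : Type} (f : α → Timed β) : List α → Timed (List β)
  | [] => do
    tick 1
    pure []
  | a :: l => do
    tick 1
    let b ← f a
    let bs ← each f l
    pure (b :: bs)

end Timed

open Timed

/-! ### Auxiliary networks -/

/-- A finite graph with the data of a linear threshold process: `weight i j` is the weight of the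
edge from `i` to `j`, `threshold i` the activation threshold of `i`, `seedable i` says whether `i`
may be put in the seed set (true for node-nodes, false for path-nodes), and `size i` is the number
of original nodes that `i` stands for. The vertices are given as a list. -/
structure AuxNet (V : Type) where
  verts : List V
  adj : V → V → Bool
  weight : V → V → ℕ
  threshold : V → ℕ
  seedable : V → Bool
  size : V → ℕ

/-- Nice tree decompositions. Every node carries its bag, as a list, whose order is the assignment
of the bag to the entries of the threshold and activation vectors. The child of `replace X u v t`
has the bag `X` with `u` replaced by `v`; both children of `join X s t` have the bag `X`. -/
inductive NiceTree (V : Type) where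
  | leaf (X : List V)
  | replace (X : List V) (u v : V) (t : NiceTree V)
  | join (X : List V) (s t : NiceTree V)

/-- The bag of the root. -/
def NiceTree.bag {V : Type} : NiceTree V → List V
  | .leaf X => X
  | .replace X _ _ _ => X
  | .join X _ _ => X

/-- All lists of length `w` with entries from `l`. -/
def vectors {α : Type} (l : List α) : ℕ → List (List α)
  | 0 => [[]]
  | w + 1 => l.flatMap fun a => (vectors l w).map fun x => a :: x

/-- Generating these lists, with time proportional to the output (all intermediate lists). -/
def vectorsT {α : Type} (l : List α) (w : ℕ) : Timed (List (List α)) := do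
  tick ((w + 1) ^ 2 * (l.length + 1) ^ w)
  pure (vectors l w)

namespace AuxNet

variable {V : Type} [DecidableEq V] (G : AuxNet V)

/-- The number of vertices. -/
def order : ℕ := G.verts.length

/-! #### A nice tree decomposition of minimum width -/

/-- The vertices of `S` that lie in `R` or have a neighbour in `R`. -/
def grow (S R : List V) : List V :=
  S.filter fun x => decide (x ∈ R) || R.any fun y => G.adj x y

/-- The connected component of `v` in the subgraph induced by `S`. -/
def component (S : List V) (v : V) : List V := (G.grow S)^[S.length] [v]

/-- The list of connected components of the subgraph induced by `S` (with `fuel = S.length`). -/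
def componentsAux : ℕ → List V → List (List V)
  | 0, _ => []
  | _ + 1, [] => []
  | fuel + 1, v :: S =>
    let C := G.component (v :: S) v
    C :: componentsAux fuel ((v :: S).filter fun x => decide (x ∉ C))

/-- The components of the subgraph induced by `S`: at most `|S|` components, each one grown in
`|S|` rounds of at most `2 |S| ^ 2` comparisons. -/
def components (S : List V) : Timed (List (List V)) := do
  tick (4 * (S.length + 1) ^ 4)
  pure (G.componentsAux S.length S)

/-- A partial solution: for a bag `X` and a component `C` of the graph without `X`, a nice tree
decomposition with root bag `X` of the subgraph induced by `X ∪ C`. -/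
abbrev Partial (V : Type) := List ((List V × List V) × NiceTree V)

/-- Table look-up by linear search, at most `2 |V| + 1` steps per entry. -/
def findPartial (tbl : Partial V) (X C : List V) : Timed (Option (NiceTree V)) := do
  tick (tbl.length * (2 * G.order + 1) + 1)
  pure (tbl.lookup (X, C))

/-- Join nice trees that all have the root bag `X`. -/
def joinAll (X : List V) : List (NiceTree V) → NiceTree V
  | [] => .leaf X
  | [t] => t
  | t :: ts => .join X t (joinAll X ts)

/-- Try to decompose `X ∪ C` by a replace node over the bag `X - u + y`, where `y ∈ C` and `u ∈ X`
has no neighbour in `C`, from the decompositions for the components of `C - y`. -/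
def tryReplace (tbl : Partial V) (X C : List V) (u y : V) : Timed (Option (NiceTree V)) := do
  tick (X.length + 2 * C.length + 1)
  if C.any fun x => G.adj u x then
    pure none
  else
    let X' := X.map fun x => if x = u then y else x
    let comps ← G.components (C.filter fun x => decide (x ≠ y))
    let ts ← each (fun C' => G.findPartial tbl X' C') comps
    tick (2 * ts.length + 1)
    if ts.all Option.isSome then
      pure (some (.replace X u y (joinAll X' ts.reduceOption)))
    else
      pure none

/-- One round: all pairs `(X, C)` that can be decomposed from the pairs in `tbl`. -/
def round (keys : List (List V × List V)) (tbl : Partial V) : Timed (Partial V) := do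
  let r ← each (fun key : List V × List V => do
    let ts ← each (fun p : V × V => G.tryReplace tbl key.1 key.2 p.1 p.2) (key.1 ×ˢ key.2)
    tick (ts.length + 1)
    pure (ts.reduceOption.head?.map fun t => (key, t))) keys
  pure r.reduceOption

/-- `r` rounds, from the empty table. -/
def rounds (keys : List (List V × List V)) : ℕ → Timed (Partial V)
  | 0 => pure []
  | r + 1 => do
    let tbl ← rounds keys r
    G.round keys tbl

/-- Search for a nice tree decomposition all of whose bags have exactly `w` vertices. -/
def treeOfBagSize (w : ℕ) : Timed (Option (NiceTree V)) := do
  let vecs ← vectorsT G.verts w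
  let bags ← each (fun X : List V => do
    tick (w ^ 2)
    pure (if X.Nodup then some X else none)) vecs
  let rooted ← each (fun X : List V => do
    tick (G.order * (w + 1))
    let comps ← G.components (G.verts.filter fun x => decide (x ∉ X))
    pure (X, comps)) bags.reduceOption
  let keys := rooted.flatMap fun p => p.2.map fun C => (p.1, C)
  tick (keys.length + 1)
  let tbl ← G.rounds keys G.order
  let roots ← each (fun p : List V × List (List V) => do
    let ts ← each (fun C => G.findPartial tbl p.1 C) p.2
    tick (2 * ts.length + 1)
    pure (if ts.all Option.isSome then some (joinAll p.1 ts.reduceOption) else none)) rooted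
  pure roots.reduceOption.head?

/-- Try the bag sizes `w, w + 1, …`, at most `fuel` of them. -/
def searchTree : ℕ → ℕ → Timed (Option (NiceTree V))
  | 0, _ => pure none
  | fuel + 1, w => do
    let t ← G.treeOfBagSize w
    match t with
    | some t => pure (some t)
    | none => searchTree fuel (w + 1)

/-- A nice tree decomposition of minimum width. -/
def niceTree : Timed (Option (NiceTree V)) := G.searchTree G.order 1

/-! #### Dynamic programming over a nice tree decomposition -/

/-- The largest threshold. -/
def maxThreshold : ℕ := (G.verts.map G.threshold).foldr max 0

/-- The set of all vertices that may be seeded, which also stands for "infeasible". -/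
def allSeeds : List V := G.verts.filter G.seedable

/-- The cardinality of a seed set: the number of original nodes it stands for. -/
def seedSize (S : List V) : ℕ := (S.map G.size).sum

/-- The smallest of the seed sets of a list (`allSeeds` if there is none). -/
def smallest : List (List V) → List V
  | [] => G.allSeeds
  | [S] => S
  | S :: l => let R := smallest l; if G.seedSize S ≤ G.seedSize R then S else R

/-- Finding the smallest of a list of seed sets, each with at most `|V|` elements. -/
def smallestT (l : List (List V)) : Timed (List V) := do
  tick ((l.length + 1) * (2 * G.order + 1))
  pure (G.smallest l)

/-- A table of seed sets, indexed by a threshold vector and an activation vector. -/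
abbrev Table (V : Type) := List ((List ℕ × List ℕ) × List V)

/-- Table look-up by linear search. -/
def entry (tbl : Table V) (c a : List ℕ) : Timed (List V) := do
  tick (tbl.length * (c.length + a.length + 1) + G.order + 1)
  pure ((tbl.lookup (c, a)).getD G.allSeeds)

/-- All pairs of a threshold vector in `{0, …, c_max} ^ w` and an activation vector in
`{0, …, w} ^ w`. -/
def indices (w : ℕ) : Timed (List (List ℕ × List ℕ)) := do
  let cs ← vectorsT (List.range (G.maxThreshold + 1)) w
  let as ← vectorsT (List.range (w + 1)) w
  tick (cs.length * as.length)
  pure (cs ×ˢ as)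

/-- Fill a table. -/
def fill (idx : List (List ℕ × List ℕ)) (f : List ℕ → List ℕ → Timed (List V)) :
    Timed (Table V) :=
  each (fun i : List ℕ × List ℕ => do
    let S ← f i.1 i.2
    pure (i, S)) idx

/-- The total weight that `x`, activating at time `t`, receives from its neighbours in the bag `X`
that activate earlier, for the activation vector `a`. -/
def received (X : List V) (a : List ℕ) (x : V) (t : ℕ) : ℕ :=
  ((X.zip a).map fun p => if G.adj p.1 x = true ∧ p.2 < t then G.weight p.1 x else 0).sum

/-- Leaf node: the smallest set `S` of seedable vertices of the bag such that each vertex of the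
bag is in `S` or reaches its threshold through neighbours that activate earlier; by enumeration
of all subsets. -/
def leafEntry (X : List V) (c a : List ℕ) : Timed (List V) := do
  let w := X.length
  let cand := (X.filter G.seedable).sublists
  tick ((w + 1) * 2 ^ w)
  let ok ← each (fun S : List V => do
    tick (w * (w + 4 * w + 1))
    pure (if (X.zip (c.zip a)).all fun p =>
        decide (p.1 ∈ S ∨ p.2.1 ≤ G.received X a p.1 p.2.2)
      then some S else none)) cand
  G.smallestT ok.reduceOption

/-- The activation vectors `a` and `b` order the entries other than the `i`-th in the same way. -/
def sameOrder (w i : ℕ) (a b : List ℕ) : Bool :=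
  (List.range w).all fun p => (List.range w).all fun q =>
    decide (p = i ∨ q = i ∨ (a.getD p 0 < a.getD q 0 ↔ b.getD p 0 < b.getD q 0))

/-- Replace node, before the edges between `u` and the rest of the bag are taken into account:
`u` has taken the entry of `v`, whose threshold is set to its true value and whose place in the
order of activation is chosen best; `u` has to be seeded unless its threshold is `0`. (Only the
order of the activation times matters, so the times of the other entries may be renumbered to make
room for `v`.) -/
def introduceEntry (X : List V) (u v : V) (tbl : Table V) (c a : List ℕ) : Timed (List V) := do
  let w := X.length
  let i := X.idxOf u
  tick (5 * w + 1)
  let as ← vectorsT (List.range (w + 1)) w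
  let l ← each (fun b : List ℕ => do
    tick (w ^ 2 * (4 * w + 4) + 1)
    if sameOrder w i a b then
      let S ← G.entry tbl (c.set i (G.threshold v)) b
      pure (some S)
    else
      pure none) as
  let S ← G.smallestT l.reduceOption
  tick (G.order + 1)
  pure (if c.getD i 0 = 0 then S else if G.seedable u then S.insert u else G.allSeeds)

/-- Replace node: take the edge between `u` and the vertex `x` of the bag into account. The one
of the two that activates first lowers the threshold of the other one. -/
def edgeEntry (X : List V) (u x : V) (tbl : Table V) (c a : List ℕ) : Timed (List V) := do
  let w := X.length
  let i := X.idxOf u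
  let j := X.idxOf x
  tick (6 * w + 1)
  if a.getD j 0 = a.getD i 0 then
    G.entry tbl c a
  else if a.getD j 0 < a.getD i 0 then
    G.entry tbl (c.set i (c.getD i 0 - G.weight x u)) a
  else
    G.entry tbl (c.set j (c.getD j 0 - G.weight u x)) a

/-- Replace node: process the edges between `u` and the listed vertices one after the other. -/
def processEdges (idx : List (List ℕ × List ℕ)) (X : List V) (u : V) :
    List V → Table V → Timed (Table V)
  | [], tbl => pure tbl
  | x :: l, tbl => do
    let tbl' ← fill idx fun c a => G.edgeEntry X u x tbl c a
    processEdges idx X u l tbl'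

/-- Join node: the smallest union of a seed set of the left and of the right subtree, over all
ways to split the thresholds. The weight received inside of the bag is available in both subtrees,
so it is added once; `f + g = c + red` is capped at `2 c_max`, the largest sum of two threshold
entries (where it is exceeded, the weight received inside of the bag alone suffices). -/
def joinEntry (X : List V) (tbl₀ tbl₁ : Table V) (c a : List ℕ) : Timed (List V) := do
  let w := X.length
  let M := G.maxThreshold
  tick (w * (4 * w + 4))
  let target := (X.zip (c.zip a)).map fun p => min (p.2.1 + G.received X a p.1 p.2.2) (2 * M)
  let fs ← vectorsT (List.range (M + 1)) w
  let l ← each (fun f : List ℕ => do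
    tick (4 * w + 1)
    let g := List.zipWith (fun s t => s - t) target f
    if (f.zip target).all (fun p => decide (p.1 ≤ p.2)) && g.all (fun s => decide (s ≤ M)) then
      let S₀ ← G.entry tbl₀ f a
      let S₁ ← G.entry tbl₁ g a
      tick (G.order ^ 2)
      pure (some (S₀ ∪ S₁))
    else
      pure none) fs
  G.smallestT l.reduceOption

/-- The table of a node of the tree, computed from the leaves upwards. -/
def dpTable : NiceTree V → Timed (Table V)
  | .leaf X => do
    let idx ← G.indices X.length
    fill idx fun c a => G.leafEntry X c a
  | .replace X u v t => do
    let tbl ← dpTable t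
    let idx ← G.indices X.length
    let tbl' ← fill idx fun c a => G.introduceEntry X u v tbl c a
    tick (2 * X.length)
    G.processEdges idx X u (X.filter fun x => G.adj u x) tbl'
  | .join X s t => do
    let tbl₀ ← dpTable s
    let tbl₁ ← dpTable t
    let idx ← G.indices X.length
    fill idx fun c a => G.joinEntry X tbl₀ tbl₁ c a

/-- The seed set read off at the root: true thresholds, best activation vector. -/
def solveOn (t : NiceTree V) : Timed (List V) := do
  tick (2 * G.order)
  let tbl ← G.dpTable t
  let w := t.bag.length
  let as ← vectorsT (List.range (w + 1)) w
  let l ← each (fun a => G.entry tbl (t.bag.map G.threshold) a) as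
  G.smallestT l

/-- The algorithm: find a nice tree decomposition of minimum width, then compute a minimum seed
set by dynamic programming over it. -/
def solve : Timed (List V) := do
  let t ← G.niceTree
  match t with
  | none => pure []
  | some t => G.solveOn t

end AuxNet

/-! ### The random auxiliary graph -/

/-- The vertices: `m` path-nodes, and `N` node-nodes in each of `k` tiers. -/
abbrev AuxVertex (m k N : ℕ) : Type := Fin m ⊕ Fin k × Fin N

/-- Path-node `j` is joined to node-node `i` of tier `l` if and only if `f j l = i`. -/
def auxAdj {m k N : ℕ} (f : Fin m → Fin k → Fin N) : AuxVertex m k N → AuxVertex m k N → Prop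
  | .inl j, .inr a => f j a.1 = a.2
  | .inr a, .inl j => f j a.1 = a.2
  | _, _ => False

instance {m k N : ℕ} (f : Fin m → Fin k → Fin N) : DecidableRel (auxAdj f)
  | .inl j, .inr a => inferInstanceAs (Decidable (f j a.1 = a.2))
  | .inr a, .inl j => inferInstanceAs (Decidable (f j a.1 = a.2))
  | .inl _, .inl _ => inferInstanceAs (Decidable False)
  | .inr _, .inr _ => inferInstanceAs (Decidable False)

/-- The auxiliary graph. -/
def auxGraph {m k N : ℕ} (f : Fin m → Fin k → Fin N) : SimpleGraph (AuxVertex m k N) where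
  Adj := auxAdj f
  symm := ⟨by
    rintro (i | i) (j | j) h
    · exact h
    · exact h
    · exact h
    · exact h⟩
  loopless := ⟨by
    rintro (i | i) h
    · exact h
    · exact h⟩

/-- The auxiliary graph as a threshold network: path-nodes have threshold `k - 1` and cannot be
seeded, node-node `a` has threshold `c a`, edges have weight `1` towards path-nodes and weight
`W j a` from path-node `j` to node-node `a`. -/
def auxNet {m k N : ℕ} (f : Fin m → Fin k → Fin N) (c : Fin k × Fin N → ℕ)
    (W : Fin m → Fin k × Fin N → ℕ) : AuxNet (AuxVertex m k N) where
  verts := (List.finRange m).map Sum.inl ++ (List.finRange k ×ˢ List.finRange N).map Sum.inr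
  adj x y := decide (auxAdj f x y)
  weight x y := match x, y with
    | .inl j, .inr a => W j a
    | _, _ => 1
  threshold x := match x with
    | .inl _ => k - 1
    | .inr a => c a
  seedable x := x.isRight
  size _ := 1

/-- `f j l` is the index of a point of tier `l` that is closest to the path point `z j`. -/
def IsClosest {m k N : ℕ} (z : Fin m → unitInterval) (y : Fin k → Fin N → unitInterval)
    (f : Fin m → Fin k → Fin N) : Prop :=
  ∀ j l i, |(z j : ℝ) - y l (f j l)| ≤ |(z j : ℝ) - y l i|

/-- With `m N` path points and `N` points in each of `k` tiers, all independent and uniform on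
`[0, 1]`, the property `P` of the resulting connections (for every choice among closest points,
should there be ties) has probability tending to `1` as `N → ∞`. -/
def Whp (k : ℕ) (m : ℕ → ℕ) (P : ∀ N, (Fin (m N) → Fin k → Fin N) → Prop) : Prop :=
  Tendsto (fun N => (volume : Measure ((Fin (m N) → unitInterval) × (Fin k → Fin N → unitInterval)))
    {s | ∀ f, IsClosest s.1 s.2 f → P N f}) atTop (𝓝 1)

/-! ### Timed computations -/

namespace Timed

variable {α β : Type}

/-! Almost surely no path point is equidistant from two points of one tier. Then the path-nodes
joined to a given node-node are consecutive in the order of position on the interval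
(`IsClosest.isConsecutive`), and everything else is deterministic.

Sweep the path-nodes from left to right: the bags made of a path-node and its `k` neighbours form a
path decomposition of width `k`, up to isolated vertices (`treewidth_auxGraph_le`). The treewidth is
thus at most `k`, a constant, whereas the bound claimed in (1) tends to infinity.

For the running time, the search has to succeed at a bounded bag size. `IsStrategy` abstracts a way
of taking the graph apart by exchanging one bag vertex at a time; any such strategy forces the
tabulation to find a tree (`IsStrategy.treeOfBagSize_ne_none`), and the same sweep is a strategy
with bags of size `k + 1` (`isStrategy_sweepInvariant`). The search therefore never tries a size
above `k + 1`, and the trees it returns have linearly many nodes (`treeOfBagSize_sound`). With bags,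
thresholds and activation times all bounded, each table is polynomial. All costs are measured as
powers of one base `Q` that exceeds the number of vertices and the constants
(`powBound_time_solve`). For `m = o(n²)` this gives `n ^ O(1) = 2 ^ O(log n)`, which settles both
(2) and (3). -/

@[simp] theorem time_pure (a : α) : (pure a : Timed α).time = 0 := rfl

@[simp] theorem val_pure (a : α) : (pure a : Timed α).val = a := rfl

@[simp] theorem time_bind (x : Timed α) (f : α → Timed β) :
    (x >>= f).time = x.time + (f x.val).time := rfl

@[simp] theorem val_bind (x : Timed α) (f : α → Timed β) : (x >>= f).val = (f x.val).val := rfl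

@[simp] theorem time_tick (c : ℕ) : (tick c).time = c := rfl

@[simp] theorem val_each (f : α → Timed β) (l : List α) :
    (each f l).val = l.map fun a => (f a).val := by
  induction l with
  | nil => simp [each]
  | cons a l ih => simp [each, ih]

theorem time_each_le {f : α → Timed β} {l : List α} {T : ℕ} (h : ∀ a ∈ l, (f a).time ≤ T) :
    (each f l).time ≤ (l.length + 1) * (T + 1) := by
  induction l with
  | nil => simp [each]
  | cons a l ih =>
    have h1 := h a (by simp)
    have h2 := ih fun b hb => h b (by simp [hb])
    simp only [each, time_bind, time_tick, time_pure, List.length_cons]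
    calc 1 + ((f a).time + ((each f l).time + 0)) ≤ 1 + (T + ((l.length + 1) * (T + 1) + 0)) := by
          gcongr
      _ = _ := by ring

end Timed

/-! ### Bounds by powers of a fixed base -/

/-- `x` is at most `Q ^ e`. -/
def PowBound (Q e x : ℕ) : Prop := x ≤ Q ^ e

namespace PowBound

variable {Q e e' x y : ℕ}

theorem weaken (hQ : 2 ≤ Q) (h : PowBound Q e x) (he : e ≤ e') : PowBound Q e' x :=
  h.trans (Nat.pow_le_pow_right (by omega) he)

/-- Exponents are added where their maximum would do, and the factor 2 costs one more. Crude, but it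
turns every later estimate into a linear inequality between exponents. -/
theorem add (hQ : 2 ≤ Q) (h : PowBound Q e x) (h' : PowBound Q e' y) :
    PowBound Q (e + e' + 1) (x + y) := by
  have h1 := h.weaken hQ (Nat.le_add_right e e')
  have h2 := h'.weaken hQ (Nat.le_add_left e' e)
  unfold PowBound at *
  calc x + y ≤ Q ^ (e + e') * 2 := by omega
    _ ≤ _ := by rw [pow_succ]; gcongr

theorem mul (h : PowBound Q e x) (h' : PowBound Q e' y) : PowBound Q (e + e') (x * y) := by
  unfold PowBound at *
  rw [pow_add]
  gcongr

theorem pow (h : PowBound Q e x) (n : ℕ) : PowBound Q (e * n) (x ^ n) := by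
  unfold PowBound at *
  rw [pow_mul]
  gcongr

theorem mono (h : PowBound Q e y) (hxy : x ≤ y) : PowBound Q e x := hxy.trans h

theorem of_le (h : x ≤ Q) : PowBound Q 1 x := by simpa [PowBound] using h

theorem zero : PowBound Q e 0 := Nat.zero_le _

end PowBound

/-! ### Components -/

theorem List.Sublist.filter_mem_eq {α : Type} [DecidableEq α] {l m : List α} (h : l.Sublist m)
    (hm : m.Nodup) : (m.filter fun x => decide (x ∈ l)) = l := by
  have h1 : l.Sublist (m.filter fun x => decide (x ∈ l)) := by
    have := h.filter fun x => decide (x ∈ l)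
    rwa [List.filter_eq_self.2 (by simp)] at this
  refine (h1.eq_of_length_le ?_).symm
  refine (List.Nodup.subperm (hm.filter _) fun x hx => ?_).length_le
  simpa using (List.mem_filter.1 hx).2

/-- Table look-up compares lists literally, so a component must have only one representing list.
Being a sublist of a fixed duplicate-free list guarantees this. -/
theorem List.Sublist.eq_of_mem_iff {α : Type} [DecidableEq α] {l l' m : List α}
    (h : l.Sublist m) (h' : l'.Sublist m) (hm : m.Nodup) (hl : ∀ x, x ∈ l ↔ x ∈ l') : l = l' := by
  rw [← h.filter_mem_eq hm, ← h'.filter_mem_eq hm]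
  simp only [hl]

namespace AuxNet

variable {V : Type} [DecidableEq V] {G : AuxNet V}

/-- `C` lists the vertices of a connected component of the subgraph induced by `S`. -/
structure IsComp (G : AuxNet V) (S C : List V) : Prop where
  sublist : C.Sublist S
  ne_nil : C ≠ []
  closed : ∀ x ∈ C, ∀ y ∈ S, G.adj x y = true → y ∈ C
  conn : ∀ D : V → Prop, (∃ x ∈ C, D x) →
    (∀ x ∈ C, D x → ∀ y ∈ C, G.adj x y = true → D y) → ∀ x ∈ C, D x

/-- The field `conn` is a propagation principle; here the propagated property is membership in the
other component. -/
theorem IsComp.eq_of_mem {S C D : List V} (hS : S.Nodup) (hC : G.IsComp S C) (hD : G.IsComp S D)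
    {x : V} (hxC : x ∈ C) (hxD : x ∈ D) : C = D := by
  refine hC.sublist.eq_of_mem_iff hD.sublist hS fun z => ⟨fun hz => ?_, fun hz => ?_⟩
  · exact hC.conn (· ∈ D) ⟨x, hxC, hxD⟩
      (fun a _ haD b hb hab => hD.closed a haD b (hC.sublist.subset hb) hab) z hz
  · exact hD.conn (· ∈ C) ⟨x, hxD, hxC⟩
      (fun a _ haC b hb hab => hC.closed a haC b (hD.sublist.subset hb) hab) z hz

theorem mem_grow {S R : List V} {x : V} :
    x ∈ G.grow S R ↔ x ∈ S ∧ (x ∈ R ∨ ∃ y ∈ R, G.adj x y = true) := by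
  simp [grow]

/-- For a nonempty list at least one round of growth is performed, and the last round is a filter.
This lets lengths be split between a component and the rest. -/
theorem component_eq_filter (v : V) (S : List V) :
    ∃ p : V → Bool, G.component (v :: S) v = (v :: S).filter p := by
  rw [component, List.length_cons, Function.iterate_succ_apply']
  exact ⟨_, rfl⟩

theorem sublist_grow {S R : List V} (h : R.Sublist S) : R.Sublist (G.grow S R) := by
  have := h.filter fun x => decide (x ∈ R) || R.any fun y => G.adj x y
  rwa [List.filter_eq_self.2 (by simp +contextual)] at this

theorem grow_iterate_sublist {S : List V} {v : V} (hv : v ∈ S) (i : ℕ) :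
    ((G.grow S)^[i] [v]).Sublist S := by
  cases i with
  | zero => simpa using hv
  | succ i => rw [Function.iterate_succ_apply']; exact List.filter_sublist

theorem mem_grow_iterate {S : List V} {v : V} (hv : v ∈ S) (i : ℕ) :
    v ∈ (G.grow S)^[i] [v] := by
  induction i with
  | zero => simp
  | succ i ih => rw [Function.iterate_succ_apply', mem_grow]; exact ⟨hv, .inl ih⟩

/-- Each round either changes nothing, and then nothing changes any more, or adds a vertex. Hence
`S.length` rounds reach a fixed point. -/
theorem grow_iterate_stable {S : List V} {v : V} (hv : v ∈ S) (i : ℕ) :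
    G.grow S ((G.grow S)^[i] [v]) = (G.grow S)^[i] [v] ∨ i + 1 ≤ ((G.grow S)^[i] [v]).length := by
  induction i with
  | zero => right; simp
  | succ i ih =>
    rw [Function.iterate_succ_apply']
    rcases ih with h | h
    · left; rw [h, h]
    · by_cases he : G.grow S ((G.grow S)^[i] [v]) = (G.grow S)^[i] [v]
      · left; rw [he, he]
      · right
        by_contra hlt
        exact he ((sublist_grow (grow_iterate_sublist hv i)).eq_of_length_le (by omega)).symm

theorem grow_component {S : List V} {v : V} (hv : v ∈ S) :
    G.grow S (G.component S v) = G.component S v := by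
  rcases grow_iterate_stable (G := G) hv S.length with h | h
  · exact h
  · have := (grow_iterate_sublist (G := G) hv S.length).length_le
    omega

theorem isComp_component (hsymm : ∀ x y, G.adj x y = G.adj y x) {S : List V} {v : V}
    (hv : v ∈ S) : G.IsComp S (G.component S v) := by
  have hvC : v ∈ G.component S v := mem_grow_iterate hv _
  have hsub : (G.component S v).Sublist S := grow_iterate_sublist hv _
  have key : ∀ D : V → Prop, D v →
      (∀ x ∈ G.component S v, D x → ∀ y ∈ G.component S v, G.adj x y = true → D y) →
      ∀ x ∈ G.component S v, D x := by
    intro D hDv hD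
    have : ∀ i, ∀ x ∈ (G.grow S)^[i] [v], x ∈ G.component S v → D x := by
      intro i
      induction i with
      | zero => intro x hx _; simp at hx; exact hx ▸ hDv
      | succ i ih =>
        intro x hx hxC
        rw [Function.iterate_succ_apply', mem_grow] at hx
        have hstep : ∀ y, y ∈ (G.grow S)^[i] [v] → G.adj x y = true → D x := by
          intro y hy hxy
          have hyx : G.adj y x = true := by rw [hsymm, hxy]
          have hyC : y ∈ G.component S v := by
            rw [← grow_component hv, mem_grow]
            exact ⟨(grow_iterate_sublist hv i).subset hy, .inr ⟨x, hxC, hyx⟩⟩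
          exact hD y hyC (ih y hy hyC) x hxC hyx
        rcases hx.2 with h | ⟨y, hy, hxy⟩
        · exact ih x h hxC
        · exact hstep y hy hxy
    exact fun x hx => this _ x hx hx
  refine ⟨hsub, List.ne_nil_of_mem hvC, fun x hx y hy hxy => ?_, fun D ⟨x₀, hx₀, hDx₀⟩ hD => ?_⟩
  · rw [← grow_component hv, mem_grow]
    exact ⟨hy, .inr ⟨x, hx, by rw [hsymm, hxy]⟩⟩
  · by_cases hDv : D v
    · exact key D hDv hD
    -- If `D` fails at `v`, then by symmetry of adjacency its negation also propagates, and reaches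
    -- `x₀`.
    · have := key (fun x => ¬ D x) hDv fun x hx hnx y hy hxy hDy =>
        hnx (hD y hy hDy x hx (by rw [hsymm, hxy]))
      exact absurd hDx₀ (this x₀ hx₀)

theorem length_componentsAux_le (fuel : ℕ) (S : List V) :
    (G.componentsAux fuel S).length ≤ fuel := by
  induction fuel generalizing S with
  | zero => simp [componentsAux]
  | succ n ih =>
    cases S with
    | nil => simp [componentsAux]
    | cons v S => simpa [componentsAux] using ih _

/-- The components are disjoint. This is what keeps the size of the trees linear. -/
theorem sum_length_componentsAux_le (fuel : ℕ) (S : List V) :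
    ((G.componentsAux fuel S).map List.length).sum ≤ S.length := by
  induction fuel generalizing S with
  | zero => simp [componentsAux]
  | succ n ih =>
    cases S with
    | nil => simp [componentsAux]
    | cons v S =>
      obtain ⟨p, hp⟩ := component_eq_filter (G := G) v S
      simp only [componentsAux, List.map_cons, List.sum_cons]
      refine (Nat.add_le_add_left (ih _) _).trans ?_
      rw [hp, (v :: S).length_eq_length_filter_add p]
      refine Nat.add_le_add_left (List.Sublist.length_le ?_) _
      have : ((v :: S).filter fun x => decide (x ∉ (v :: S).filter p)) =
          ((v :: S).filter fun x => !p x) := by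
        refine List.filter_congr fun x hx => ?_
        simp only [List.mem_filter, hx, true_and]
        simp
      rw [this]

/-- No edge joins the component that is removed to the remainder, so a component of the remainder is
closed in all of `S`. -/
theorem isComp_of_mem_componentsAux (hsymm : ∀ x y, G.adj x y = G.adj y x) {fuel : ℕ}
    {S C : List V} (hC : C ∈ G.componentsAux fuel S) : G.IsComp S C := by
  induction fuel generalizing S with
  | zero => simp [componentsAux] at hC
  | succ n ih =>
    cases S with
    | nil => simp [componentsAux] at hC
    | cons v S =>
      have h1 := isComp_component hsymm (List.mem_cons_self (a := v) (l := S))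
      simp only [componentsAux, List.mem_cons] at hC
      rcases hC with rfl | hC
      · exact h1
      · have h2 := ih hC
        refine ⟨h2.sublist.trans List.filter_sublist, h2.ne_nil, fun x hx y hy hxy => ?_, h2.conn⟩
        have hx' := List.mem_filter.1 (h2.sublist.subset hx)
        refine h2.closed x hx y (List.mem_filter.2 ⟨hy, ?_⟩) hxy
        simp only [decide_not, Bool.not_eq_eq_eq_not, Bool.not_true, decide_eq_false_iff_not] at hx' ⊢
        exact fun hyC => hx'.2 (h1.closed y hyC x hx'.1 (by rw [hsymm, hxy]))

theorem exists_mem_componentsAux {fuel : ℕ} {S : List V} (hS : S.length ≤ fuel) {x : V}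
    (hx : x ∈ S) : ∃ C ∈ G.componentsAux fuel S, x ∈ C := by
  induction fuel generalizing S with
  | zero => simp_all
  | succ n ih =>
    cases S with
    | nil => simp at hx
    | cons v S =>
      simp only [componentsAux, List.mem_cons, exists_eq_or_imp]
      by_cases hxC : x ∈ G.component (v :: S) v
      · exact .inl hxC
      · refine .inr (ih ?_ (List.mem_filter.2 ⟨hx, by simpa using hxC⟩))
        have hv : v ∈ G.component (v :: S) v := mem_grow_iterate List.mem_cons_self _
        have : ((v :: S).filter fun x => decide (x ∉ G.component (v :: S) v)).length <
            (v :: S).length :=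
          List.length_filter_lt_length_iff_exists.2 ⟨v, by simp, by simpa using hv⟩
        simp only [List.length_cons] at this hS
        omega

theorem mem_components_iff (hsymm : ∀ x y, G.adj x y = G.adj y x) {S C : List V} (hS : S.Nodup) :
    C ∈ (G.components S).val ↔ G.IsComp S C := by
  refine ⟨isComp_of_mem_componentsAux hsymm, fun hC => ?_⟩
  obtain ⟨x, hx⟩ := List.exists_mem_of_ne_nil _ hC.ne_nil
  obtain ⟨D, hD, hxD⟩ := exists_mem_componentsAux (G := G) le_rfl (hC.sublist.subset hx)
  have := hC.eq_of_mem hS (isComp_of_mem_componentsAux hsymm hD) hx hxD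
  exact this ▸ hD

end AuxNet

/-! ### Nice trees -/

theorem mem_vectors {α : Type} {l : List α} {w : ℕ} {x : List α} :
    x ∈ vectors l w ↔ x.length = w ∧ ∀ a ∈ x, a ∈ l := by
  induction w generalizing x with
  | zero => simp +contextual [vectors]
  | succ w ih =>
    simp only [vectors, List.mem_flatMap, List.mem_map, ih]
    constructor
    · rintro ⟨a, ha, y, ⟨hy, hyl⟩, rfl⟩
      simpa [hy, ha] using hyl
    · cases x with
      | nil => simp
      | cons a y =>
        simp only [List.length_cons, Nat.add_right_cancel_iff, List.mem_cons, forall_eq_or_imp]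
        exact fun ⟨h1, h2, h3⟩ => ⟨a, h2, y, ⟨h1, h3⟩, rfl⟩

theorem length_vectors {α : Type} (l : List α) (w : ℕ) : (vectors l w).length = l.length ^ w := by
  induction w with
  | zero => simp [vectors]
  | succ w ih => simp [vectors, List.length_flatMap, ih, pow_succ']

namespace NiceTree

variable {V : Type}

/-- The number of nodes. -/
def numNodes : NiceTree V → ℕ
  | .leaf _ => 1
  | .replace _ _ _ t => t.numNodes + 1
  | .join _ s t => s.numNodes + t.numNodes + 1

/-- Every bag has `w` entries. -/
def HasBagSize (w : ℕ) : NiceTree V → Prop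
  | .leaf X => X.length = w
  | .replace X _ _ t => X.length = w ∧ t.HasBagSize w
  | .join X s t => X.length = w ∧ s.HasBagSize w ∧ t.HasBagSize w

theorem HasBagSize.length_bag {w : ℕ} {t : NiceTree V} (h : t.HasBagSize w) :
    t.bag.length = w := by
  cases t with
  | leaf X => exact h
  | replace X u v t => exact h.1
  | join X s t => exact h.1

end NiceTree

namespace AuxNet

open NiceTree

variable {V : Type}

theorem hasBagSize_joinAll {w : ℕ} {X : List V} (hX : X.length = w) {ts : List (NiceTree V)}
    (h : ∀ t ∈ ts, t.HasBagSize w) : (joinAll X ts).HasBagSize w := by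
  induction ts with
  | nil => exact hX
  | cons t ts ih =>
    cases ts with
    | nil => exact h t (by simp)
    | cons s ts => exact ⟨hX, h t (by simp), ih fun r hr => h r (by simp [hr])⟩

/-- Joining `r ≥ 1` trees takes `r - 1` join nodes, so adding one to each node count makes it
additive. The extra `2` is for the empty list, where a single leaf is produced. -/
theorem numNodes_joinAll_le (X : List V) (ts : List (NiceTree V)) :
    (joinAll X ts).numNodes + 1 ≤ (ts.map fun t => t.numNodes + 1).sum + 2 := by
  induction ts with
  | nil => simp [joinAll, numNodes]
  | cons t ts ih =>
    cases ts with
    | nil => simp [joinAll]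
    | cons s ts =>
      simp only [joinAll, numNodes, List.map_cons, List.sum_cons] at ih ⊢
      omega

variable [DecidableEq V] {G : AuxNet V}

/-- The bag `X` with `u` replaced by `y`. -/
def swap (X : List V) (u y : V) : List V := X.map fun x => if x = u then y else x

theorem length_swap (X : List V) (u y : V) : (swap X u y).length = X.length := by simp [swap]

theorem mem_swap {X : List V} {u y z : V} (hu : u ∈ X) :
    z ∈ swap X u y ↔ z = y ∨ z ∈ X ∧ z ≠ u := by
  simp only [swap, List.mem_map]
  constructor
  · rintro ⟨x, hx, rfl⟩
    by_cases h : x = u <;> simp [h, hx]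
  · rintro (rfl | ⟨hz, hne⟩)
    · exact ⟨u, hu, by simp⟩
    · exact ⟨z, hz, by simp [hne]⟩

theorem nodup_swap {X : List V} {u y : V} (hX : X.Nodup) (hy : y ∉ X) : (swap X u y).Nodup := by
  refine List.Nodup.map_on (fun a ha b hb hab => ?_) hX
  by_cases h1 : a = u <;> by_cases h2 : b = u <;> simp_all

/-- The vertices that are not in the bag `X`. -/
def outside (G : AuxNet V) (X : List V) : List V := G.verts.filter fun x => decide (x ∉ X)

theorem mem_outside {X : List V} {x : V} : x ∈ G.outside X ↔ x ∈ G.verts ∧ x ∉ X := by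
  simp [outside]

/-- Since `u` has no neighbour in `C`, releasing it from the bag does not enlarge any component of
`C - y`. -/
theorem IsComp.swap {X C C' : List V} {u y : V}
    (hsymm : ∀ x y, G.adj x y = G.adj y x) (hC : G.IsComp (G.outside X) C) (hu : u ∈ X)
    (huC : ∀ x ∈ C, G.adj u x = false)
    (hC' : G.IsComp (C.filter fun x => decide (x ≠ y)) C') :
    G.IsComp (G.outside (swap X u y)) C' := by
  have hCC : ∀ x ∈ C', x ∈ C ∧ x ≠ y := fun x hx => by
    simpa using List.mem_filter.1 (hC'.sublist.subset hx)
  refine ⟨?_, hC'.ne_nil, fun x hx z hz hxz => ?_, hC'.conn⟩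
  · have h1 : C'.Sublist G.verts :=
      (hC'.sublist.trans List.filter_sublist).trans (hC.sublist.trans List.filter_sublist)
    have h2 := h1.filter fun x => decide (x ∉ AuxNet.swap X u y)
    rwa [List.filter_eq_self.2] at h2
    intro x hx
    have h3 := hCC x hx
    have h4 := (mem_outside.1 (hC.sublist.subset h3.1)).2
    simp [mem_swap hu, h3.2, h4]
  · rw [mem_outside, mem_swap hu] at hz
    have hx' := hCC x hx
    have hzu : z ≠ u := by
      rintro rfl
      have := huC x hx'.1
      rw [hsymm, hxz] at this
      exact absurd this (by simp)
    have hzX : z ∉ X := fun h => hz.2 (.inr ⟨h, hzu⟩)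
    have hzC := hC.closed x hx'.1 z (mem_outside.2 ⟨hz.1, hzX⟩) hxz
    exact hC'.closed x hx z (List.mem_filter.2 ⟨hzC, by simpa using fun h => hz.2 (.inl h)⟩) hxz

/-! ### Results of the tabulation: tree size and success -/

@[simp] theorem val_findPartial (tbl : Partial V) (X C : List V) :
    (G.findPartial tbl X C).val = tbl.lookup (X, C) := rfl

@[simp] theorem val_vectorsT {α : Type} (l : List α) (w : ℕ) :
    (vectorsT l w).val = vectors l w := rfl

theorem val_tryReplace (tbl : Partial V) (X C : List V) (u y : V) :
    (G.tryReplace tbl X C u y).val =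
      if C.any fun x => G.adj u x then none else
        let ts := (G.components (C.filter fun x => decide (x ≠ y))).val.map
          fun C' => tbl.lookup (swap X u y, C')
        if ts.all Option.isSome then
          some (.replace X u y (joinAll (swap X u y) ts.reduceOption)) else none := by
  simp only [tryReplace, val_bind, apply_ite Timed.val, val_pure, val_each, val_findPartial, swap]
  rfl

theorem val_round (keys : List (List V × List V)) (tbl : Partial V) :
    (G.round keys tbl).val = (keys.map fun key : List V × List V =>
      (((key.1 ×ˢ key.2).map fun p : V × V =>
        (G.tryReplace tbl key.1 key.2 p.1 p.2).val).reduceOption.head?.map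
          fun t => (key, t))).reduceOption := by
  simp [round]

theorem length_round_le (keys : List (List V × List V)) (tbl : Partial V) :
    (G.round keys tbl).val.length ≤ keys.length := by
  rw [val_round]
  exact (List.reduceOption_length_le _).trans (by simp)

theorem length_rounds_le (keys : List (List V × List V)) (r : ℕ) :
    (G.rounds keys r).val.length ≤ keys.length := by
  cases r with
  | zero => simp [rounds]
  | succ r => exact length_round_le _ _

theorem mem_round {keys : List (List V × List V)} {tbl : Partial V}
    {e : (List V × List V) × NiceTree V} (he : e ∈ (G.round keys tbl).val) :
    e.1 ∈ keys ∧ ∃ u ∈ e.1.1, ∃ y ∈ e.1.2, (G.tryReplace tbl e.1.1 e.1.2 u y).val = some e.2 := by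
  rw [val_round, List.reduceOption_mem_iff, List.mem_map] at he
  obtain ⟨key, hkey, he⟩ := he
  obtain ⟨t, ht, rfl⟩ := Option.map_eq_some_iff.1 he
  have := List.mem_of_head? ht
  rw [List.reduceOption_mem_iff, List.mem_map] at this
  obtain ⟨⟨u, y⟩, hp, hpt⟩ := this
  rw [List.mem_product] at hp
  exact ⟨hkey, u, hp.1, y, hp.2, hpt⟩

theorem exists_mem_round {keys : List (List V × List V)} {tbl : Partial V} {X C : List V}
    (hkey : (X, C) ∈ keys) {u y : V} (hu : u ∈ X) (hy : y ∈ C) {t : NiceTree V}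
    (ht : (G.tryReplace tbl X C u y).val = some t) :
    ∃ t', ((X, C), t') ∈ (G.round keys tbl).val := by
  simp only [val_round, List.reduceOption_mem_iff, List.mem_map]
  have : t ∈ ((X ×ˢ C).map fun p : V × V =>
      (G.tryReplace tbl X C p.1 p.2).val).reduceOption := by
    rw [List.reduceOption_mem_iff, List.mem_map]
    exact ⟨(u, y), List.mem_product.2 ⟨hu, hy⟩, ht⟩
  obtain ⟨t', ht'⟩ := Option.ne_none_iff_exists'.1
    (fun h => List.ne_nil_of_mem this (List.head?_eq_none_iff.1 h))
  exact ⟨t', (X, C), hkey, by simp only [ht', Option.map_some]⟩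

theorem exists_lookup {tbl : Partial V} {X C : List V} (h : ∃ t, ((X, C), t) ∈ tbl) :
    (tbl.lookup (X, C)).isSome = true := by
  obtain ⟨t, ht⟩ := h
  exact List.lookup_isSome_iff.2 ⟨_, ht, by simp⟩

theorem mem_of_lookup {tbl : Partial V} {k : List V × List V} {t : NiceTree V}
    (h : tbl.lookup k = some t) : (k, t) ∈ tbl := by
  obtain ⟨l₁, l₂, h1, -⟩ := List.lookup_eq_some_iff.1 h
  simp [h1]

/-- All trees of the table have bags of size `w` and few nodes. -/
def GoodTable (w : ℕ) (tbl : Partial V) : Prop :=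
  ∀ e ∈ tbl, e.2.HasBagSize w ∧ e.2.numNodes + 1 ≤ 3 * e.1.2.length

theorem GoodTable.sum_numNodes_le {w : ℕ} {tbl : Partial V} (h : GoodTable w tbl) (X : List V)
    (cs : List (List V)) :
    (((cs.map fun C => tbl.lookup (X, C)).reduceOption).map fun t => t.numNodes + 1).sum ≤
      3 * (cs.map List.length).sum := by
  induction cs with
  | nil => simp
  | cons C cs ih =>
    simp only [List.map_cons, List.sum_cons]
    cases ht : tbl.lookup (X, C) with
    | none => rw [List.reduceOption_cons_of_none]; omega
    | some t =>
      rw [List.reduceOption_cons_of_some, List.map_cons, List.sum_cons]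
      have := (h _ (mem_of_lookup ht)).2
      simp only at this
      omega

theorem GoodTable.hasBagSize {w : ℕ} {tbl : Partial V} (h : GoodTable w tbl) {X : List V}
    {cs : List (List V)} {t : NiceTree V}
    (ht : t ∈ (cs.map fun C => tbl.lookup (X, C)).reduceOption) : t.HasBagSize w := by
  rw [List.reduceOption_mem_iff, List.mem_map] at ht
  obtain ⟨C, -, hC⟩ := ht
  exact (h _ (mem_of_lookup hC)).1

/-- The constant 3: the vertex `y` leaves the component and pays for the replace node and for the
two units by which `joinAll` may exceed the sum. -/
theorem GoodTable.round {w : ℕ} {keys : List (List V × List V)} {tbl : Partial V}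
    (hkeys : ∀ key ∈ keys, key.1.length = w) (h : GoodTable w tbl) :
    GoodTable w (G.round keys tbl).val := by
  intro e he
  obtain ⟨hkey, u, -, y, hy, ht⟩ := mem_round he
  rw [val_tryReplace] at ht
  have hw := hkeys _ hkey
  have hw' : (swap e.1.1 u y).length = w := by rw [length_swap, hw]
  split_ifs at ht with h1
  simp only at ht
  split_ifs at ht with h2
  obtain ht := (Option.some.inj ht).symm
  rw [ht]
  refine ⟨⟨hw, hasBagSize_joinAll hw' fun t => h.hasBagSize⟩, ?_⟩
  have h3 := numNodes_joinAll_le (swap e.1.1 u y)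
    ((G.components (e.1.2.filter fun x => decide (x ≠ y))).val.map
      fun C' => tbl.lookup (swap e.1.1 u y, C')).reduceOption
  have h4 := h.sum_numNodes_le (swap e.1.1 u y)
    (G.components (e.1.2.filter fun x => decide (x ≠ y))).val
  have h5 : ((G.components (e.1.2.filter fun x => decide (x ≠ y))).val.map List.length).sum ≤
    (e.1.2.filter fun x => decide (x ≠ y)).length := sum_length_componentsAux_le _ _
  have h6 : (e.1.2.filter fun x => decide (x ≠ y)).length < e.1.2.length :=
    List.length_filter_lt_length_iff_exists.2 ⟨y, hy, by simp⟩
  simp only [numNodes]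
  omega

theorem goodTable_rounds {w : ℕ} {keys : List (List V × List V)}
    (hkeys : ∀ key ∈ keys, key.1.length = w) (r : ℕ) : GoodTable w (G.rounds keys r).val := by
  induction r with
  | zero => intro e he; simp [rounds] at he
  | succ r ih => exact ih.round hkeys

/-- The bags of size `w`. -/
def bags (G : AuxNet V) (w : ℕ) : List (List V) :=
  ((vectors G.verts w).map fun X => if X.Nodup then some X else none).reduceOption

theorem mem_bags {w : ℕ} {X : List V} :
    X ∈ G.bags w ↔ X.Nodup ∧ X.length = w ∧ ∀ x ∈ X, x ∈ G.verts := by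
  simp only [bags, List.reduceOption_mem_iff, List.mem_map, mem_vectors]
  constructor
  · rintro ⟨Y, hY, h⟩
    split_ifs at h with h1
    obtain rfl := Option.some.inj h
    exact ⟨h1, hY⟩
  · rintro ⟨h1, h2⟩
    exact ⟨X, h2, by simp [h1]⟩

theorem length_bags_le (w : ℕ) : (G.bags w).length ≤ G.order ^ w := by
  refine (List.reduceOption_length_le _).trans ?_
  rw [List.length_map, length_vectors, order]

/-- The bags of size `w` with the components of the rest of the graph. -/
def rooted (G : AuxNet V) (w : ℕ) : List (List V × List (List V)) :=
  (G.bags w).map fun X => (X, (G.components (G.outside X)).val)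

/-- The pairs of a bag of size `w` and a component of the rest of the graph. -/
def keys (G : AuxNet V) (w : ℕ) : List (List V × List V) :=
  (G.rooted w).flatMap fun p => p.2.map fun C => (p.1, C)

theorem mem_keys {w : ℕ} {X C : List V} :
    (X, C) ∈ G.keys w ↔ X ∈ G.bags w ∧ C ∈ (G.components (G.outside X)).val := by
  simp only [keys, rooted, List.mem_flatMap, List.mem_map]
  constructor
  · rintro ⟨p, ⟨Y, hY, rfl⟩, D, hD, h⟩
    obtain ⟨rfl, rfl⟩ := Prod.mk.inj h
    exact ⟨hY, hD⟩
  · rintro ⟨h1, h2⟩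
    exact ⟨_, ⟨X, h1, rfl⟩, C, h2, rfl⟩

theorem length_outside_le (X : List V) : (G.outside X).length ≤ G.order :=
  List.length_filter_le _ _

theorem length_keys_le (w : ℕ) : (G.keys w).length ≤ G.order ^ w * G.order := by
  simp only [keys, List.length_flatMap, List.length_map, rooted, List.map_map]
  refine (List.sum_le_card_nsmul _ G.order fun x hx => ?_).trans ?_
  · obtain ⟨X, -, rfl⟩ := List.mem_map.1 hx
    exact (length_componentsAux_le _ _).trans (length_outside_le X)
  · simp only [List.length_map, smul_eq_mul]
    exact Nat.mul_le_mul_right _ (length_bags_le w)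

theorem val_treeOfBagSize (w : ℕ) :
    (G.treeOfBagSize w).val = ((G.rooted w).map fun p =>
      let ts := p.2.map fun C => (G.rounds (G.keys w) G.order).val.lookup (p.1, C)
      if ts.all Option.isSome then some (joinAll p.1 ts.reduceOption) else none).reduceOption.head? := by
  simp only [treeOfBagSize, rooted, keys, bags, outside, val_findPartial, val_vectorsT, val_bind,
    val_each, val_pure]
  rfl

/-- Exactly the information about the tree that the cost of the dynamic program depends on. -/
theorem treeOfBagSize_sound {w : ℕ} {t : NiceTree V} (ht : (G.treeOfBagSize w).val = some t) :
    t.HasBagSize w ∧ t.numNodes ≤ 3 * G.order + 1 := by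
  rw [val_treeOfBagSize] at ht
  have := List.mem_of_head? ht
  rw [List.reduceOption_mem_iff, List.mem_map] at this
  obtain ⟨p, hp, h⟩ := this
  obtain ⟨X, hX, rfl⟩ := List.mem_map.1 hp
  simp only at h
  split_ifs at h with h1
  obtain rfl := Option.some.inj h
  have hgood : GoodTable w (G.rounds (G.keys w) G.order).val :=
    goodTable_rounds (fun key hkey => (mem_bags.1 (mem_keys.1 hkey).1).2.1) _
  refine ⟨hasBagSize_joinAll (mem_bags.1 hX).2.1 fun t => hgood.hasBagSize, ?_⟩
  have h3 := numNodes_joinAll_le X (((G.components (G.outside X)).val.map fun C =>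
    (G.rounds (G.keys w) G.order).val.lookup (X, C)).reduceOption)
  have h4 := hgood.sum_numNodes_le X (G.components (G.outside X)).val
  have h5 : ((G.components (G.outside X)).val.map List.length).sum ≤
    (G.outside X).length := sum_length_componentsAux_le _ _
  have h6 := length_outside_le (G := G) X
  omega

/-- `P X C` is an invariant under which the component `C` outside of the bag `X` can be taken
apart by exchanging one vertex of the bag at a time. -/
def IsStrategy (G : AuxNet V) (w : ℕ) (P : List V → List V → Prop) : Prop :=
  ∀ X ∈ G.bags w, ∀ C, G.IsComp (G.outside X) C → P X C →
    ∃ u ∈ X, ∃ y ∈ C, (∀ x ∈ C, G.adj u x = false) ∧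
      ∀ C', G.IsComp (C.filter fun x => decide (x ≠ y)) C' → P (swap X u y) C'

/-- After `r` rounds all components with at most `r` vertices that satisfy the invariant are solved:
the move of the strategy removes `y`, so the new components are smaller and were solved a round
before. -/
theorem IsStrategy.exists_mem_rounds {w : ℕ} {P : List V → List V → Prop}
    (hP : G.IsStrategy w P) (hnd : G.verts.Nodup) (hsymm : ∀ x y, G.adj x y = G.adj y x) (r : ℕ)
    {X C : List V} (hX : X ∈ G.bags w) (hC : G.IsComp (G.outside X) C) (hr : C.length ≤ r)
    (hXC : P X C) : ∃ t, ((X, C), t) ∈ (G.rounds (G.keys w) r).val := by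
  induction r generalizing X C with
  | zero => exact absurd (List.length_eq_zero_iff.1 (Nat.le_zero.1 hr)) hC.ne_nil
  | succ r ih =>
    obtain ⟨u, hu, y, hy, huC, hnext⟩ := hP X hX C hC hXC
    have hkey : (X, C) ∈ G.keys w :=
      mem_keys.2 ⟨hX, (mem_components_iff hsymm (hnd.filter _)).2 hC⟩
    have hCnd : C.Nodup := hC.sublist.nodup (hnd.filter _)
    have hyV := mem_outside.1 (hC.sublist.subset hy)
    have hXb := mem_bags.1 hX
    have hX' : swap X u y ∈ G.bags w := by
      refine mem_bags.2 ⟨nodup_swap hXb.1 hyV.2, by rw [length_swap, hXb.2.1], fun z hz => ?_⟩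
      rcases (mem_swap hu).1 hz with rfl | h
      · exact hyV.1
      · exact hXb.2.2 z h.1
    refine exists_mem_round hkey hu hy (t := .replace X u y (joinAll (swap X u y)
      ((G.components (C.filter fun x => decide (x ≠ y))).val.map
        fun C' => (G.rounds (G.keys w) r).val.lookup (swap X u y, C')).reduceOption)) ?_
    · rw [val_tryReplace, if_neg (by simpa using huC)]
      refine if_pos (List.all_eq_true.2 fun o ho => ?_)
      obtain ⟨C', hC', rfl⟩ := List.mem_map.1 ho
      rw [mem_components_iff hsymm (hCnd.filter _)] at hC'
      refine exists_lookup (ih hX' (hC.swap hsymm hu huC hC') ?_ (hnext C' hC'))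
      have h1 := hC'.sublist.length_le
      have h2 : (C.filter fun x => decide (x ≠ y)).length < C.length :=
        List.length_filter_lt_length_iff_exists.2 ⟨y, hy, by simp⟩
      omega

theorem IsStrategy.treeOfBagSize_ne_none {w : ℕ} {P : List V → List V → Prop}
    (hP : G.IsStrategy w P) (hnd : G.verts.Nodup) (hsymm : ∀ x y, G.adj x y = G.adj y x)
    {X : List V} (hX : X ∈ G.bags w) (hXP : ∀ C, G.IsComp (G.outside X) C → P X C) :
    (G.treeOfBagSize w).val ≠ none := by
  rw [val_treeOfBagSize, Ne, List.head?_eq_none_iff]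
  refine List.ne_nil_of_mem (a := joinAll X ((G.components (G.outside X)).val.map fun C =>
    (G.rounds (G.keys w) G.order).val.lookup (X, C)).reduceOption) ?_
  rw [List.reduceOption_mem_iff, List.mem_map]
  refine ⟨(X, (G.components (G.outside X)).val), List.mem_map.2 ⟨X, hX, rfl⟩, ?_⟩
  refine if_pos (List.all_eq_true.2 fun o ho => ?_)
  obtain ⟨C, hC, rfl⟩ := List.mem_map.1 ho
  replace hC : G.IsComp (G.outside X) C := (mem_components_iff hsymm (hnd.filter _)).1 hC
  exact exists_lookup (hP.exists_mem_rounds hnd hsymm _ hX hC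
    (hC.sublist.length_le.trans (length_outside_le X)) (hXP C hC))

end AuxNet

/-! ### Running time of the search for a tree -/

theorem PowBound.succ {Q e x : ℕ} (hQ : 2 ≤ Q) (h : PowBound Q e x) :
    PowBound Q (e + 1) (x + 1) :=
  (h.add (e' := 0) hQ (by simp [PowBound])).weaken hQ le_rfl

theorem PowBound.time_each {α β : Type} {Q e e' : ℕ} {f : α → Timed β} {l : List α} (hQ : 2 ≤ Q)
    (hl : PowBound Q e l.length) (h : ∀ a ∈ l, PowBound Q e' (f a).time) :
    PowBound Q (e + 1 + (e' + 1)) (each f l).time :=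
  ((hl.succ hQ).mul (PowBound.succ (x := Q ^ e') hQ le_rfl)).mono (time_each_le h)

namespace AuxNet

variable {V : Type} {G : AuxNet V}

/-- The base `Q` exceeds the numbers of vertices, the thresholds, the bag sizes up to `K`, and the
constants that occur in the running times. -/
structure Scale (G : AuxNet V) (K Q : ℕ) : Prop where
  order : G.order + 8 ≤ Q
  threshold : G.maxThreshold + 8 ≤ Q
  width : K + 8 ≤ Q

variable {K Q : ℕ}

theorem Scale.two_le (h : G.Scale K Q) : 2 ≤ Q := by have := h.order; omega

theorem Scale.four (h : G.Scale K Q) : PowBound Q 1 4 := .of_le (by have := h.order; omega)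

theorem Scale.two (h : G.Scale K Q) : PowBound Q 1 2 := .of_le (by have := h.order; omega)

theorem Scale.of_le_order (h : G.Scale K Q) {x : ℕ} (hx : x ≤ G.order) : PowBound Q 1 x :=
  .of_le (by have := h.order; omega)

theorem Scale.of_le_width (h : G.Scale K Q) {x : ℕ} (hx : x ≤ K) : PowBound Q 1 x :=
  .of_le (by have := h.width; omega)

theorem powBound_time_vectorsT (h : G.Scale K Q) {α : Type} {l : List α} {w : ℕ} (hw : w ≤ K)
    (hl : l.length + 1 ≤ Q) : PowBound Q (K + 4) (vectorsT l w).time := by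
  have h2 := h.two_le
  have hw' := h.of_le_width hw
  have hl' : PowBound Q 1 (l.length + 1) := .of_le hl
  exact PowBound.weaken h2 (((hw'.succ h2).pow 2).mul (hl'.pow w)) (by omega)

theorem length_val_indices (w : ℕ) :
    (G.indices w).val.length = (G.maxThreshold + 1) ^ w * (w + 1) ^ w := by
  simp [indices, List.length_product, length_vectors]

theorem mem_indices {w : ℕ} {i : List ℕ × List ℕ} (hi : i ∈ (G.indices w).val) :
    i.1.length = w ∧ i.2.length = w := by
  simp only [indices, val_bind, val_vectorsT, val_pure] at hi
  obtain ⟨h1, h2⟩ := List.mem_product.1 hi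
  exact ⟨(mem_vectors.1 h1).1, (mem_vectors.1 h2).1⟩

theorem Scale.powBound_length_indices (h : G.Scale K Q) {w : ℕ} (hw : w ≤ K) :
    PowBound Q (2 * K) (G.indices w).val.length := by
  rw [length_val_indices]
  have h1 : PowBound Q 1 (G.maxThreshold + 1) := .of_le (by have := h.threshold; omega)
  have h2 : PowBound Q 1 (w + 1) := .of_le (by have := h.width; omega)
  exact ((h1.pow w).mul (h2.pow w)).weaken h.two_le (by omega)

theorem length_val_fill (idx : List (List ℕ × List ℕ)) (f : List ℕ → List ℕ → Timed (List V)) :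
    (fill idx f).val.length = idx.length := by
  simp [fill]

theorem Scale.powBound_time_thresholds (h : G.Scale K Q) {w : ℕ} (hw : w ≤ K) :
    PowBound Q (K + 4) (vectorsT (List.range (G.maxThreshold + 1)) w).time :=
  powBound_time_vectorsT h hw (by simp; have := h.threshold; omega)

theorem Scale.powBound_time_activations (h : G.Scale K Q) {w : ℕ} (hw : w ≤ K) :
    PowBound Q (K + 4) (vectorsT (List.range (w + 1)) w).time :=
  powBound_time_vectorsT h hw (by simp; have := h.width; omega)

theorem Scale.powBound_length_thresholds (h : G.Scale K Q) {w : ℕ} (hw : w ≤ K) :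
    PowBound Q K (vectors (List.range (G.maxThreshold + 1)) w).length := by
  rw [length_vectors, List.length_range]
  exact ((PowBound.of_le (by have := h.threshold; omega)).pow w).weaken h.two_le (by omega)

theorem Scale.powBound_length_activations (h : G.Scale K Q) {w : ℕ} (hw : w ≤ K) :
    PowBound Q K (vectors (List.range (w + 1)) w).length := by
  rw [length_vectors, List.length_range]
  exact ((PowBound.of_le (by have := h.width; omega)).pow w).weaken h.two_le (by omega)

theorem powBound_time_indices (h : G.Scale K Q) {w : ℕ} (hw : w ≤ K) :
    PowBound Q (4 * K + 20) (G.indices w).time := by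
  have h2 := h.two_le
  simp only [indices, time_bind, time_tick, val_vectorsT, time_pure, add_zero]
  exact PowBound.weaken h2 ((h.powBound_time_thresholds hw).add h2
    ((h.powBound_time_activations hw).add h2
      ((h.powBound_length_thresholds hw).mul (h.powBound_length_activations hw)))) (by omega)

theorem powBound_time_smallestT (h : G.Scale K Q) {t : ℕ} {l : List (List V)}
    (hl : PowBound Q t l.length) : PowBound Q (t + 4) (G.smallestT l).time := by
  have h2 := h.two_le
  exact ((hl.succ h2).mul ((h.two.mul (h.of_le_order le_rfl)).succ h2)).weaken h2 (by omega)

theorem powBound_time_entry (h : G.Scale K Q) {t : ℕ} {tbl : Table V} {c a : List ℕ}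
    (ht : PowBound Q t tbl.length) (hc : c.length ≤ K) (ha : a.length ≤ K) :
    PowBound Q (t + 10) (G.entry tbl c a).time := by
  have h2 := h.two_le
  exact (((ht.mul (((h.of_le_width hc).add h2 (h.of_le_width ha)).succ h2)).add h2
    (h.of_le_order le_rfl)).succ h2).weaken h2 (by omega)

theorem powBound_time_fill {t e : ℕ} (hQ : 2 ≤ Q) {idx : List (List ℕ × List ℕ)}
    {f : List ℕ → List ℕ → Timed (List V)} (hidx : PowBound Q t idx.length)
    (hf : ∀ i ∈ idx, PowBound Q e (f i.1 i.2).time) :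
    PowBound Q (t + e + 2) (fill idx f).time := by
  refine PowBound.weaken hQ (PowBound.time_each (e' := e) hQ hidx fun i hi => ?_) (by omega)
  simpa using hf i hi

variable [DecidableEq V]

theorem powBound_time_components (h : G.Scale K Q) {S : List V} (hS : S.length ≤ G.order) :
    PowBound Q 9 (G.components S).time :=
  h.four.mul (((h.of_le_order hS).succ h.two_le).pow 4)

theorem powBound_time_findPartial (h : G.Scale K Q) {t : ℕ} {tbl : Partial V} {X C : List V}
    (ht : PowBound Q t tbl.length) : PowBound Q (t + 4) (G.findPartial tbl X C).time := by
  have h2 := h.two_le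
  exact (ht.mul ((h.two.mul (h.of_le_order le_rfl)).succ h2)).succ h2

theorem length_val_components_le (S : List V) : (G.components S).val.length ≤ S.length :=
  length_componentsAux_le _ _

theorem powBound_time_tryReplace (h : G.Scale K Q) {t : ℕ} {tbl : Partial V} {X C : List V}
    (ht : PowBound Q t tbl.length) (hX : X.length ≤ K) (hC : C.length ≤ G.order) (u y : V) :
    PowBound Q (t + 40) (G.tryReplace tbl X C u y).time := by
  have h2 := h.two_le
  have hX' := h.of_le_width hX
  have hC' := h.of_le_order hC
  have htick : PowBound Q 5 (X.length + 2 * C.length + 1) :=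
    (hX'.add h2 (h.two.mul hC')).succ h2
  unfold tryReplace
  simp only [time_bind, time_tick]
  split_ifs with h1
  · exact htick.weaken h2 (by omega)
  have hle : (C.filter fun x => decide (x ≠ y)).length ≤ G.order :=
    (List.length_filter_le _ _).trans hC
  have hcomps := h.of_le_order ((length_val_components_le (G := G) _).trans hle)
  simp only [time_bind, time_tick, val_each, List.length_map, apply_ite Timed.time,
    time_pure, ite_self]
  refine PowBound.weaken h2 (htick.add h2 ((powBound_time_components h hle).add h2
    ((PowBound.time_each h2 hcomps fun C' _ => powBound_time_findPartial h ht).add h2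
      (((h.two.mul hcomps).succ h2).add (e' := 0) h2 .zero)))) ?_
  omega

theorem powBound_time_round (h : G.Scale K Q) {t : ℕ} {tbl : Partial V}
    {keys : List (List V × List V)} (ht : PowBound Q t tbl.length)
    (hkeys : PowBound Q t keys.length)
    (hkey : ∀ key ∈ keys, key.1.length ≤ K ∧ key.2.length ≤ G.order) :
    PowBound Q (2 * t + 60) (G.round keys tbl).time := by
  have h2 := h.two_le
  unfold round
  simp only [time_bind, time_pure, add_zero]
  refine PowBound.weaken h2 (PowBound.time_each (e' := t + 50) h2 hkeys fun key hk => ?_) (by omega)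
  obtain ⟨hX, hC⟩ := hkey key hk
  have hlen : PowBound Q 2 (key.1 ×ˢ key.2).length := by
    rw [List.length_product]
    exact (h.of_le_width hX).mul (h.of_le_order hC)
  simp only [time_bind, time_tick, val_each, List.length_map, time_pure, add_zero]
  refine PowBound.weaken h2 ((PowBound.time_each h2 hlen fun p _ =>
    powBound_time_tryReplace h ht hX hC p.1 p.2).add h2 (hlen.succ h2)) (by omega)

/-- The number of rounds is kept as a factor: adding up `PowBound`s round by round would let the
exponent grow with `r`. -/
theorem time_rounds_le (h : G.Scale K Q) {t : ℕ} {keys : List (List V × List V)}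
    (hkeys : PowBound Q t keys.length)
    (hkey : ∀ key ∈ keys, key.1.length ≤ K ∧ key.2.length ≤ G.order) (r : ℕ) :
    (G.rounds keys r).time ≤ r * Q ^ (2 * t + 60) := by
  induction r with
  | zero => simp [rounds]
  | succ r ih =>
    simp only [rounds, time_bind]
    have := powBound_time_round h (hkeys.mono (length_rounds_le (G := G) keys r)) hkeys hkey
    unfold PowBound at this
    linarith

theorem powBound_time_treeOfBagSize (h : G.Scale K Q) {w : ℕ} (hw : w ≤ K) :
    PowBound Q (9 * K + 150) (G.treeOfBagSize w).time := by
  have h2 := h.two_le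
  have hw' := h.of_le_width hw
  have hord := h.of_le_order le_rfl
  have hvlen : PowBound Q K (vectors G.verts w).length := by
    rw [length_vectors]
    exact (hord.pow w).weaken h2 (by omega)
  have hblen : PowBound Q K (G.bags w).length :=
    ((hord.pow w).mono (length_bags_le w)).weaken h2 (by omega)
  have hklen : PowBound Q (K + 1) (G.keys w).length :=
    (((hord.pow w).mul hord).mono (length_keys_le w)).weaken h2 (by omega)
  have hkey : ∀ key ∈ G.keys w, key.1.length ≤ K ∧ key.2.length ≤ G.order := by
    rintro ⟨X, C⟩ hk
    obtain ⟨hX, hC⟩ := mem_keys.1 hk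
    refine ⟨by rw [(mem_bags.1 hX).2.1]; exact hw, ?_⟩
    have hs : ((G.components (G.outside X)).val.map List.length).sum ≤ (G.outside X).length :=
      sum_length_componentsAux_le _ _
    exact (List.le_sum_of_mem (List.mem_map_of_mem hC)).trans (hs.trans (length_outside_le X))
  have hrounds : PowBound Q (2 * K + 64) (G.rounds (G.keys w) G.order).time :=
    ((hord.mul (PowBound.weaken h2 (e := 2 * (K + 1) + 60) le_rfl le_rfl)).mono
      (time_rounds_le h hklen hkey G.order)).weaken h2 (by omega)
  -- The cost, rewritten in terms of `bags`, `keys` and `rooted`, whose lengths are bounded above.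
  have htime : (G.treeOfBagSize w).time = (vectorsT G.verts w).time +
      ((each (fun X : List V => do
        tick (w ^ 2)
        pure (if X.Nodup then some X else none)) (vectors G.verts w)).time +
      ((each (fun X : List V => do
        tick (G.order * (w + 1))
        let comps ← G.components (G.outside X)
        pure (X, comps)) (G.bags w)).time +
      ((G.keys w).length + 1 + ((G.rounds (G.keys w) G.order).time +
      (each (fun p : List V × List (List V) => do
        let ts ← each (fun C => G.findPartial (G.rounds (G.keys w) G.order).val p.1 C) p.2
        tick (2 * ts.length + 1)
        pure (if ts.all Option.isSome then some (joinAll p.1 ts.reduceOption) else none))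
        (G.rooted w)).time)))) := by
    simp only [treeOfBagSize, rooted, keys, bags, outside, val_vectorsT, val_bind, val_each,
      val_pure, time_bind, time_tick, time_pure, add_zero]
  rw [htime]
  have hverts : G.verts.length + 1 ≤ Q := (Nat.add_le_add_left (by omega) _).trans h.order
  refine PowBound.weaken h2 ((powBound_time_vectorsT h hw hverts).add h2
    ((PowBound.time_each (e' := 2) h2 hvlen fun X _ => ?_).add h2
    ((PowBound.time_each (e' := 13) h2 hblen fun X _ => ?_).add h2
    ((hklen.succ h2).add h2 (hrounds.add h2
    (PowBound.time_each (e := K) (e' := K + 20) h2 ?_ fun p hp => ?_)))))) (by omega)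
  · simpa using hw'.pow 2
  · simp only [time_bind, time_tick, time_pure, add_zero]
    exact PowBound.weaken h2 ((hord.mul (hw'.succ h2)).add h2
      (powBound_time_components h (length_outside_le X))) (by omega)
  · simpa [rooted] using hblen
  · obtain ⟨X, hX, rfl⟩ := List.mem_map.1 hp
    have hc := h.of_le_order
      ((length_val_components_le (G := G) (G.outside X)).trans (length_outside_le X))
    simp only [time_bind, time_tick, val_each, List.length_map, time_pure, add_zero]
    exact PowBound.weaken h2 ((PowBound.time_each h2 hc fun C _ =>
      powBound_time_findPartial h (hklen.mono (length_rounds_le _ _))).add h2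
      ((h.two.mul hc).succ h2)) (by omega)

/-- The search goes no further than the size `w₀`, at which it succeeds. If the fuel runs out
earlier the result is `none`, at no further cost, so the bound does not involve `fuel`. -/
theorem searchTree_spec {T w₀ : ℕ} (hT : ∀ w ≤ w₀, (G.treeOfBagSize w).time ≤ T)
    (hne : (G.treeOfBagSize w₀).val ≠ none) (fuel w : ℕ) (hw : w ≤ w₀) :
    (G.searchTree fuel w).time ≤ (w₀ + 1 - w) * T ∧
      ∀ t, (G.searchTree fuel w).val = some t →
        ∃ w' ≤ w₀, (G.treeOfBagSize w').val = some t := by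
  induction fuel generalizing w with
  | zero => simp [searchTree]
  | succ n ih =>
    simp only [searchTree, time_bind, val_bind]
    cases hv : (G.treeOfBagSize w).val with
    | some t =>
      refine ⟨?_, fun s hs => ⟨w, hw, by rw [hv]; exact hs⟩⟩
      rw [show w₀ + 1 - w = (w₀ - w) + 1 by omega, add_mul, one_mul]
      exact (hT w hw).trans (Nat.le_add_left _ _)
    | none =>
      have hlt : w < w₀ := lt_of_le_of_ne hw fun h => hne (h ▸ hv)
      obtain ⟨h1, h2⟩ := ih (w + 1) hlt
      refine ⟨?_, h2⟩
      rw [show w₀ + 1 - w = (w₀ + 1 - (w + 1)) + 1 by omega, add_mul, one_mul, add_comm]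
      exact Nat.add_le_add h1 (hT w hw)

/-! ### Running time of the dynamic program -/

theorem powBound_time_leafEntry (h : G.Scale K Q) {X : List V} (hX : X.length ≤ K)
    (c a : List ℕ) : PowBound Q (3 * K + 40) (G.leafEntry X c a).time := by
  have h2 := h.two_le
  have hw := h.of_le_width hX
  have hpow : PowBound Q K (2 ^ X.length) := (h.two.pow _).weaken h2 (by omega)
  have hcand : PowBound Q K (X.filter G.seedable).sublists.length := by
    rw [List.length_sublists]
    exact hpow.mono (Nat.pow_le_pow_right (by omega) (List.length_filter_le _ _))
  simp only [leafEntry, time_bind, time_tick]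
  refine PowBound.weaken h2 (((hw.succ h2).mul hpow).add h2
    ((PowBound.time_each (e' := 10) h2 hcand fun S _ => ?_).add h2
      (powBound_time_smallestT (t := K) h (hcand.mono ?_)))) (by omega)
  · simp only [time_bind, time_tick, time_pure, add_zero]
    exact PowBound.weaken h2 (hw.mul ((hw.add h2 (h.four.mul hw)).succ h2)) (by omega)
  · rw [val_each]
    exact (List.reduceOption_length_le _).trans (by rw [List.length_map])

theorem powBound_time_introduceEntry (h : G.Scale K Q) {t : ℕ} {X : List V} {tbl : Table V}
    {c a : List ℕ} (ht : PowBound Q t tbl.length) (hX : X.length ≤ K) (hc : c.length ≤ K)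
    (u v : V) : PowBound Q (3 * K + t + 60) (G.introduceEntry X u v tbl c a).time := by
  have h2 := h.two_le
  have hw := h.of_le_width hX
  have h5 : PowBound Q 1 5 := .of_le (by have := h.order; omega)
  have has := h.powBound_length_activations hX
  simp only [introduceEntry, time_bind, time_tick, time_pure, add_zero, val_vectorsT]
  refine PowBound.weaken h2 (((h5.mul hw).succ h2).add h2
    ((h.powBound_time_activations hX).add h2
    ((PowBound.time_each (e' := t + 30) h2 has fun b hb => ?_).add h2
    ((powBound_time_smallestT (t := K) h (has.mono ?_)).add h2
      ((h.of_le_order le_rfl).succ h2))))) (by omega)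
  · have htick := ((hw.pow 2).mul ((h.four.mul hw).add h2 h.four)).succ h2
    split_ifs
    · simp only [time_bind, time_pure, add_zero]
      exact PowBound.weaken h2 (htick.add h2 (powBound_time_entry h ht (by simpa using hc)
        ((mem_vectors.1 hb).1.le.trans hX))) (by omega)
    · exact PowBound.weaken h2 htick (by omega)
  · rw [val_each]
    exact (List.reduceOption_length_le _).trans (by rw [List.length_map])

theorem powBound_time_edgeEntry (h : G.Scale K Q) {t : ℕ} {X : List V} {tbl : Table V}
    {c a : List ℕ} (ht : PowBound Q t tbl.length) (hX : X.length ≤ K) (hc : c.length ≤ K)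
    (ha : a.length ≤ K) (u x : V) : PowBound Q (t + 30) (G.edgeEntry X u x tbl c a).time := by
  have h2 := h.two_le
  have h6 : PowBound Q 1 6 := .of_le (by have := h.order; omega)
  have htick := (h6.mul (h.of_le_width hX)).succ h2
  simp only [edgeEntry, time_bind, time_tick]
  split_ifs
  all_goals
    exact PowBound.weaken h2 (htick.add h2 (powBound_time_entry h ht (by simpa using hc) ha))
      (by omega)

/-- Every intermediate table has the size of the index list, so the cost per edge stays the same and
only the number of edges enters as a factor. -/
theorem processEdges_spec (h : G.Scale K Q) {t : ℕ} {idx : List (List ℕ × List ℕ)} {X : List V}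
    (hX : X.length ≤ K) (hidx : PowBound Q t idx.length)
    (hmem : ∀ i ∈ idx, i.1.length ≤ K ∧ i.2.length ≤ K) (u : V) (l : List V) {tbl : Table V}
    (ht : tbl.length = idx.length) :
    (G.processEdges idx X u l tbl).time ≤ l.length * Q ^ (2 * t + 32) ∧
      (G.processEdges idx X u l tbl).val.length = idx.length := by
  induction l generalizing tbl with
  | nil => simp [processEdges, ht]
  | cons x l ih =>
    simp only [processEdges, time_bind, val_bind]
    have h1 : PowBound Q (2 * t + 32) (fill idx fun c a => G.edgeEntry X u x tbl c a).time :=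
      PowBound.weaken h.two_le (powBound_time_fill h.two_le hidx fun i hi =>
        powBound_time_edgeEntry h (ht ▸ hidx) hX (hmem i hi).1 (hmem i hi).2 u x) (by omega)
    obtain ⟨h2, h3⟩ := ih (length_val_fill idx fun c a => G.edgeEntry X u x tbl c a)
    refine ⟨?_, h3⟩
    rw [List.length_cons, add_mul, one_mul, add_comm]
    exact Nat.add_le_add h2 h1

theorem powBound_time_joinEntry (h : G.Scale K Q) {t : ℕ} {X : List V} {tbl₀ tbl₁ : Table V}
    {c a : List ℕ} (h₀ : PowBound Q t tbl₀.length) (h₁ : PowBound Q t tbl₁.length)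
    (hX : X.length ≤ K) (ha : a.length ≤ K) :
    PowBound Q (3 * K + 2 * t + 80) (G.joinEntry X tbl₀ tbl₁ c a).time := by
  have h2 := h.two_le
  have hw := h.of_le_width hX
  have hfs := h.powBound_length_thresholds hX
  simp only [joinEntry, time_bind, time_tick, val_vectorsT]
  refine PowBound.weaken h2 ((hw.mul ((h.four.mul hw).add h2 h.four)).add h2
    ((h.powBound_time_thresholds hX).add h2
    ((PowBound.time_each (e' := 2 * t + 40) h2 hfs fun f hf => ?_).add h2
    (powBound_time_smallestT (t := K) h (hfs.mono ?_))))) (by omega)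
  · have htick := (h.four.mul hw).succ h2
    have hf' : f.length ≤ K := (mem_vectors.1 hf).1.le.trans hX
    split_ifs
    · simp only [time_bind, time_tick, time_pure, add_zero]
      refine PowBound.weaken h2 (htick.add h2 ((powBound_time_entry h h₀ hf' ha).add h2
        ((powBound_time_entry h h₁ ?_ ha).add h2 ((h.of_le_order le_rfl).pow 2)))) (by omega)
      rw [List.length_zipWith]
      exact (min_le_right _ _).trans hf'
    · exact PowBound.weaken h2 htick (by omega)
  · rw [val_each]
    exact (List.reduceOption_length_le _).trans (by rw [List.length_map])

/-- The table length is part of the induction: the cost at a node depends on its children only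
through the size of their tables, which is the same throughout the tree. -/
theorem dpTable_spec (h : G.Scale K Q) {w : ℕ} (hw : w ≤ K) {t : NiceTree V}
    (ht : t.HasBagSize w) :
    (G.dpTable t).time ≤ t.numNodes * Q ^ (20 * K + 200) ∧
      (G.dpTable t).val.length = (G.indices w).val.length := by
  have h2 := h.two_le
  have hidx := h.powBound_length_indices hw
  have hidxt := powBound_time_indices h hw
  have hmem : ∀ i ∈ (G.indices w).val, i.1.length ≤ K ∧ i.2.length ≤ K := fun i hi =>
    ⟨(mem_indices hi).1.le.trans hw, (mem_indices hi).2.le.trans hw⟩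
  induction t with
  | leaf X =>
    obtain rfl : X.length = w := ht
    simp only [dpTable, time_bind, val_bind, length_val_fill, NiceTree.numNodes, one_mul, and_true]
    exact PowBound.weaken h2 (hidxt.add h2 (powBound_time_fill h2 hidx fun i _ =>
      powBound_time_leafEntry h hw i.1 i.2)) (by omega)
  | replace X u v t ih =>
    obtain ⟨rfl, ht⟩ := ht
    obtain ⟨ih1, ih2⟩ := ih ht
    simp only [dpTable, time_bind, val_bind, NiceTree.numNodes, time_tick]
    obtain ⟨h3, h4⟩ := processEdges_spec h hw hidx hmem u (X.filter fun x => G.adj u x)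
      (length_val_fill (G.indices X.length).val
        fun c a => G.introduceEntry X u v (G.dpTable t).val c a)
    refine ⟨?_, h4⟩
    rw [add_mul, one_mul]
    refine Nat.add_le_add ih1 ?_
    refine PowBound.weaken h2 (hidxt.add h2 ((powBound_time_fill h2 hidx fun i hi =>
      powBound_time_introduceEntry h (ih2 ▸ hidx) hw (hmem i hi).1 u v).add h2
      ((h.two.mul (h.of_le_width hw)).add h2
      (((h.of_le_width ((List.length_filter_le _ _).trans hw)).mul
        (e' := 2 * (2 * K) + 32) le_rfl).mono h3)))) (by omega)
  | join X s t ihs iht =>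
    obtain ⟨rfl, hs, ht⟩ := ht
    obtain ⟨hs1, hs2⟩ := ihs hs
    obtain ⟨ht1, ht2⟩ := iht ht
    simp only [dpTable, time_bind, val_bind, length_val_fill, NiceTree.numNodes, and_true]
    rw [add_mul, add_mul, one_mul, add_assoc]
    refine Nat.add_le_add hs1 (Nat.add_le_add ht1 ?_)
    exact PowBound.weaken h2 (hidxt.add h2 (powBound_time_fill h2 hidx fun i hi =>
      powBound_time_joinEntry h (hs2 ▸ hidx) (ht2 ▸ hidx) hw (hmem i hi).2)) (by omega)

theorem powBound_time_solveOn (h : G.Scale K Q) {w : ℕ} (hw : w ≤ K) {t : NiceTree V}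
    (ht : t.HasBagSize w) (hsize : t.numNodes ≤ 3 * G.order + 1) :
    PowBound Q (30 * K + 300) (G.solveOn t).time := by
  have h2 := h.two_le
  obtain ⟨h3, h4⟩ := dpTable_spec h hw ht
  have hlen : PowBound Q (2 * K) (G.dpTable t).val.length := h4 ▸ h.powBound_length_indices hw
  have hthree : PowBound Q 1 3 := .of_le (by have := h.order; omega)
  have hnodes : PowBound Q 3 t.numNodes :=
    ((hthree.mul (h.of_le_order le_rfl)).succ h2).mono hsize
  have has := h.powBound_length_activations hw
  simp only [solveOn, time_bind, time_tick, val_vectorsT, ht.length_bag]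
  refine PowBound.weaken h2 ((h.two.mul (h.of_le_order le_rfl)).add h2
    (((hnodes.mul (e' := 20 * K + 200) le_rfl).mono h3).add h2
    ((h.powBound_time_activations hw).add h2
    ((PowBound.time_each h2 has fun a ha => powBound_time_entry h hlen
      (by rw [List.length_map, ht.length_bag]; exact hw) ((mem_vectors.1 ha).1.le.trans hw)).add h2
    (powBound_time_smallestT (t := K) h (has.mono (by rw [val_each, List.length_map]))))))) (by omega)

theorem powBound_time_solve (h : G.Scale K Q) (hK : 1 ≤ K)
    (hne : (G.treeOfBagSize K).val ≠ none) : PowBound Q (40 * K + 500) G.solve.time := by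
  have h2 := h.two_le
  obtain ⟨h3, h4⟩ := searchTree_spec (T := Q ^ (9 * K + 150))
    (fun w hw => powBound_time_treeOfBagSize h hw) hne G.order 1 hK
  have h5 : PowBound Q (9 * K + 151) G.niceTree.time :=
    (((h.of_le_width le_rfl).mul (e' := 9 * K + 150) le_rfl).mono
      (h3.trans (by simp))).weaken h2 (by omega)
  simp only [solve, time_bind]
  cases hv : G.niceTree.val with
  | none => exact h5.weaken h2 (by omega)
  | some t =>
    obtain ⟨w, hw, ht⟩ := h4 t hv
    obtain ⟨h6, h7⟩ := treeOfBagSize_sound ht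
    exact PowBound.weaken h2 (h5.add h2 (powBound_time_solveOn h hw h6 h7)) (by omega)

end AuxNet

/-! ### The auxiliary graph along the unit interval -/

/-- In the order given by the positions `z`, the path-nodes that are joined to a given node-node
are consecutive. -/
def IsConsecutive {m k N : ℕ} (z : Fin m → ℝ) (f : Fin m → Fin k → Fin N) : Prop :=
  ∀ l p q r, z p ≤ z q → z q ≤ z r → f p l = f r l → f q l = f p l

section

variable {m k N : ℕ} {f : Fin m → Fin k → Fin N} {c : Fin k × Fin N → ℕ}
  {W : Fin m → Fin k × Fin N → ℕ}

theorem auxNet_adj_symm (x y : AuxVertex m k N) :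
    (auxNet f c W).adj x y = (auxNet f c W).adj y x :=
  decide_eq_decide.2 ⟨(auxGraph f).symm.symm x y, (auxGraph f).symm.symm y x⟩

theorem mem_verts_auxNet (x : AuxVertex m k N) : x ∈ (auxNet f c W).verts := by
  rcases x with j | ⟨l, i⟩ <;> simp [auxNet]

theorem nodup_verts_auxNet : (auxNet f c W).verts.Nodup := by
  refine List.Nodup.append ((List.nodup_finRange m).map Sum.inl_injective)
    (((List.nodup_finRange k).product (List.nodup_finRange N)).map Sum.inr_injective) ?_
  intro x hx hy
  obtain ⟨j, -, rfl⟩ := List.mem_map.1 hx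
  obtain ⟨a, -, ha⟩ := List.mem_map.1 hy
  exact absurd ha (by simp)

theorem order_auxNet : (auxNet f c W).order = m + k * N := by
  simp [auxNet, AuxNet.order, List.length_product]

theorem maxThreshold_auxNet_le {M : ℕ} (hc : ∀ a, c a ≤ M) :
    (auxNet f c W).maxThreshold ≤ M + k := by
  have : ∀ l : List (AuxVertex m k N),
      (l.map (auxNet f c W).threshold).foldr max 0 ≤ M + k := by
    intro l
    induction l with
    | nil => simp
    | cons x l ih =>
      rw [List.map_cons, List.foldr_cons]
      refine max_le ?_ ih
      rcases x with j | a
      · simp only [auxNet]; omega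
      · exact (hc a).trans (Nat.le_add_right _ _)
  exact this _

theorem adj_inl_inr {j : Fin m} {a : Fin k × Fin N} :
    (auxNet f c W).adj (.inl j) (.inr a) = true ↔ f j a.1 = a.2 := decide_eq_true_iff

theorem adj_inr_inl {j : Fin m} {a : Fin k × Fin N} :
    (auxNet f c W).adj (.inr a) (.inl j) = true ↔ f j a.1 = a.2 := decide_eq_true_iff

theorem adj_inl_inl {i j : Fin m} : (auxNet f c W).adj (.inl i) (.inl j) = false :=
  decide_eq_false_iff_not.2 id

theorem adj_inr_inr {a b : Fin k × Fin N} : (auxNet f c W).adj (.inr a) (.inr b) = false :=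
  decide_eq_false_iff_not.2 id

/-- The invariant of the sweep from left to right: the path-nodes of the bag `X` have no
neighbours in `C`, and a node-node of the bag that has a neighbour in `C` is joined to all
path-nodes of `C` on the left of it. -/
def SweepInvariant (z : Fin m → ℝ) (f : Fin m → Fin k → Fin N) (X C : List (AuxVertex m k N)) :
    Prop :=
  (∀ j l, .inl j ∈ X → .inr (l, f j l) ∉ C) ∧
    ∀ a : Fin k × Fin N, .inr a ∈ X → ∀ p q, .inl p ∈ C → .inl q ∈ C → z q ≤ z p →
      f p a.1 = a.2 → f q a.1 = a.2

/-- Pigeonhole for the sweep: a bag of `k + 1` vertices contains one that is not a neighbour of the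
path-node `j`. -/
theorem length_le_of_subset_neighbors {X : List (AuxVertex m k N)} (hX : X.Nodup) (j : Fin m)
    (h : ∀ x ∈ X, ∃ l, x = .inr (l, f j l)) : X.length ≤ k := by
  have hsub : X ⊆ (List.finRange k).map fun l => (Sum.inr (l, f j l) : AuxVertex m k N) := by
    intro x hx
    obtain ⟨l, rfl⟩ := h x hx
    exact List.mem_map.2 ⟨l, List.mem_finRange l, rfl⟩
  simpa using (hX.subperm hsub).length_le

/-- Let `j` be the leftmost path-node of `C`. By the invariant, a bag vertex with a neighbour in `C`
is a node-node joined to `j`. There are at most `k` of these, so one of the `k + 1` bag vertices can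
be released. Its place goes to a neighbour of `j` missing from the bag, or to `j` itself once all
its neighbours are present. -/
theorem isStrategy_sweepInvariant {z : Fin m → ℝ} (hz : IsConsecutive z f) :
    (auxNet f c W).IsStrategy (k + 1) (SweepInvariant z f) := by
  intro X hX C hC hP
  obtain ⟨hXnd, hXlen, -⟩ := AuxNet.mem_bags.1 hX
  have hCX : ∀ x ∈ C, x ∉ X := fun x hx => (AuxNet.mem_outside.1 (hC.sublist.subset hx)).2
  have hsub : ∀ y C', (auxNet f c W).IsComp (C.filter fun x => decide (x ≠ y)) C' →
      ∀ x ∈ C', x ∈ C ∧ x ≠ y := fun y C' hC' x hx => by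
    simpa using List.mem_filter.1 (hC'.sublist.subset hx)
  have hinl : ∀ j, .inl j ∈ X → ∀ x ∈ C, (auxNet f c W).adj (.inl j) x = false := by
    rintro j hj (i | ⟨l, i⟩) hx
    · exact adj_inl_inl
    · rw [← Bool.not_eq_true, adj_inl_inr]
      exact fun h => hP.1 j l hj (h ▸ hx)
  by_cases hpath : ∃ j : Fin m, (.inl j : AuxVertex m k N) ∈ C
  · obtain ⟨j, hj, hmin⟩ := Set.exists_min_image {j : Fin m | (.inl j : AuxVertex m k N) ∈ C} z
      (Set.toFinite _) hpath
    have hu : ∃ u ∈ X, ∀ x ∈ C, (auxNet f c W).adj u x = false := by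
      by_contra! hcon
      have := length_le_of_subset_neighbors (f := f) hXnd j fun u hu => ?_
      · omega
      obtain ⟨x, hx, hux⟩ := hcon u hu
      replace hux := Bool.eq_true_of_not_eq_false hux
      rcases u with i | a
      · rw [hinl i hu x hx] at hux
        exact absurd hux (by simp)
      rcases x with p | b
      · rw [adj_inr_inl] at hux
        exact ⟨a.1, by rw [hP.2 a hu p j hx hj (hmin p hx) hux]⟩
      · rw [adj_inr_inr] at hux
        exact absurd hux (by simp)
    obtain ⟨u, hu, huC⟩ := hu
    by_cases hall : ∀ l, (.inr (l, f j l) : AuxVertex m k N) ∈ X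
    · refine ⟨u, hu, .inl j, hj, huC, fun C' hC' => ⟨fun i l hi hil => ?_, fun a ha p q hp hq => ?_⟩⟩
      · have h1 := (hsub _ C' hC' _ hil).1
        rcases (AuxNet.mem_swap hu).1 hi with h | h
        · obtain rfl := Sum.inl_injective h
          exact hCX _ h1 (hall l)
        · exact hP.1 i l h.1 h1
      · rcases (AuxNet.mem_swap hu).1 ha with h | h
        · exact absurd h (by simp)
        · exact hP.2 a h.1 p q (hsub _ C' hC' _ hp).1 (hsub _ C' hC' _ hq).1
    · push Not at hall
      obtain ⟨l, hl⟩ := hall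
      have hy : (.inr (l, f j l) : AuxVertex m k N) ∈ C :=
        hC.closed _ hj _ (AuxNet.mem_outside.2 ⟨mem_verts_auxNet _, hl⟩) (adj_inl_inr.2 rfl)
      refine ⟨u, hu, _, hy, huC, fun C' hC' => ⟨fun i l' hi hil => ?_, fun a ha p q hp hq hqp hpa => ?_⟩⟩
      · rcases (AuxNet.mem_swap hu).1 hi with h | h
        · exact absurd h (by simp)
        · exact hP.1 i l' h.1 (hsub _ C' hC' _ hil).1
      · have hp' := (hsub _ C' hC' _ hp).1
        have hq' := (hsub _ C' hC' _ hq).1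
        rcases (AuxNet.mem_swap hu).1 ha with h | h
        · obtain rfl := Sum.inr_injective h
          -- The new bag vertex is joined to `j` and to `p`, and `q` lies between them.
          exact hz l j q p (hmin q hq') hqp hpa.symm
        · exact hP.2 a h.1 p q hp' hq' hqp hpa
  -- Without path-nodes, `C` consists of node-nodes that have no neighbours in the bag either, so
  -- any exchange is allowed.
  · have hpath' : ∀ j : Fin m, (.inl j : AuxVertex m k N) ∉ C := fun j hj => hpath ⟨j, hj⟩
    obtain ⟨u, hu⟩ := List.exists_mem_of_length_pos (l := X) (by omega)
    obtain ⟨y, hy⟩ := List.exists_mem_of_ne_nil _ hC.ne_nil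
    refine ⟨u, hu, y, hy, fun x hx => ?_, fun C' hC' => ⟨fun i l hi hil => ?_, fun a ha p q hp => ?_⟩⟩
    · rcases u with i | a
      · exact hinl i hu x hx
      · rcases x with p | b
        · exact absurd hx (hpath' p)
        · exact adj_inr_inr
    · rcases (AuxNet.mem_swap hu).1 hi with h | h
      · exact hpath' i (h ▸ hy)
      · exact hP.1 i l h.1 (hsub _ C' hC' _ hil).1
    · exact absurd (hsub _ C' hC' _ hp).1 (hpath' p)

/-- The sweep starts from the bag of the leftmost path-node and its `k` neighbours. -/
theorem treeOfBagSize_auxNet_ne_none {z : Fin m → ℝ} (hz : IsConsecutive z f) (hm : 0 < m) :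
    ((auxNet f c W).treeOfBagSize (k + 1)).val ≠ none := by
  have : Nonempty (Fin m) := ⟨⟨0, hm⟩⟩
  obtain ⟨j, hmin⟩ := Finite.exists_min z
  refine (isStrategy_sweepInvariant hz).treeOfBagSize_ne_none nodup_verts_auxNet auxNet_adj_symm
    (X := .inl j :: (List.finRange k).map fun l => .inr (l, f j l)) ?_ fun C hC => ?_
  · refine AuxNet.mem_bags.2 ⟨List.nodup_cons.2 ⟨by simp, ?_⟩, by simp,
      fun x _ => mem_verts_auxNet x⟩
    exact (List.nodup_finRange k).map fun l l' h => (Prod.mk.inj (Sum.inr_injective h)).1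
  · refine ⟨fun i l hi hil => ?_, fun a ha p q hp hq hqp hpa => ?_⟩
    · obtain rfl : i = j := by simpa using hi
      exact (AuxNet.mem_outside.1 (hC.sublist.subset hil)).2 (by simp)
    · obtain ⟨l, rfl⟩ : ∃ l, (l, f j l) = a := by simpa using ha
      exact hz l j q p (hmin q) hqp hpa.symm

theorem time_solve_auxNet_le {z : Fin m → ℝ} (hz : IsConsecutive z f) (hm : 0 < m) {M : ℕ}
    (hc : ∀ a, c a ≤ M) :
    (auxNet f c W).solve.time ≤ (m + k * N + (M + k + 9)) ^ (40 * (k + 1) + 500) :=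
  -- Here `K = k + 1`; the summand `M + k + 9` in the base covers the largest threshold, at most `M
  -- + k`, and `K`, each with the slack of 8.
  AuxNet.powBound_time_solve
    ⟨by rw [order_auxNet]; omega, by have := maxThreshold_auxNet_le (f := f) (W := W) hc; omega,
      by omega⟩ (by omega) (treeOfBagSize_auxNet_ne_none hz hm)

end

/-! ### Path decompositions -/

namespace SimpleGraph

/-- A discrete intermediate value theorem: a walk moves by one at a time and cannot skip `c`. -/
theorem pathGraph_mem_support {n : ℕ} {x y c : Fin n} (p : (pathGraph n).Walk x y) (hx : x ≤ c)
    (hy : c ≤ y) : c ∈ p.support := by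
  induction p with
  | nil => simp [le_antisymm hx hy]
  | @cons u v w h p ih =>
    rw [Walk.support_cons, List.mem_cons]
    by_cases hc : c = u
    · exact .inl hc
    · refine .inr (ih ?_ hy)
      rw [pathGraph_adj] at h
      rw [Fin.le_def] at hx ⊢
      have : (c : ℕ) ≠ u := fun h' => hc (Fin.ext h')
      omega

theorem pathGraph_mem_support' {n : ℕ} {x y c : Fin n} (p : (pathGraph n).Walk x y) (hx : c ≤ x)
    (hy : y ≤ c) : c ∈ p.support := by
  simpa using pathGraph_mem_support p.reverse hy hx

theorem Walk.IsPath.eq_of_mem_takeUntil_of_mem_dropUntil {V : Type} [DecidableEq V]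
    {G : SimpleGraph V} {x y z v : V} {p : G.Walk x y} (hp : p.IsPath) (hz : z ∈ p.support)
    (h₁ : v ∈ (p.takeUntil z hz).support) (h₂ : v ∈ (p.dropUntil z hz).support) : v = z := by
  have hnd := hp.support_nodup
  rw [← p.take_spec hz, Walk.support_append] at hnd
  rw [← Walk.cons_tail_support, List.mem_cons] at h₂
  rcases h₂ with h₂ | h₂
  · exact h₂
  · exact absurd h₂ (List.disjoint_of_nodup_append hnd h₁)

/-- If `z` were outside the interval between the ends, one end would lie between `z` and the other
end. The path would then meet that end both before and after `z`. -/
theorem pathGraph_isPath_between {n : ℕ} {x y z : Fin n} {p : (pathGraph n).Walk x y}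
    (hp : p.IsPath) (hz : z ∈ p.support) : x ≤ z ∧ z ≤ y ∨ y ≤ z ∧ z ≤ x := by
  have key : ∀ v, v ∈ (p.takeUntil z hz).support → v ∈ (p.dropUntil z hz).support → v = z :=
    fun v => hp.eq_of_mem_takeUntil_of_mem_dropUntil hz
  by_contra hcon
  push Not at hcon
  have hends : ((x ≤ y ∧ y ≤ z) ∨ (z ≤ y ∧ y ≤ x)) ∨ ((y ≤ x ∧ x ≤ z) ∨ (z ≤ x ∧ x ≤ y)) := by
    simp only [Fin.le_def]
    omega
  rcases hends with h | h
  · have := key y (h.elim (fun h => pathGraph_mem_support _ h.1 h.2)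
      fun h => pathGraph_mem_support' _ h.2 h.1) (Walk.end_mem_support _)
    subst this
    rcases le_total x y with h' | h'
    · exact lt_irrefl _ (hcon.1 h')
    · exact absurd (hcon.2 le_rfl) (not_lt.2 h')
  · have := key x (Walk.start_mem_support _) (h.elim (fun h => pathGraph_mem_support' _ h.2 h.1)
      fun h => pathGraph_mem_support _ h.1 h.2)
    subst this
    rcases le_total x y with h' | h'
    · exact absurd (hcon.1 le_rfl) (not_lt.2 h')
    · exact lt_irrefl _ (hcon.2 h')

theorem pathGraph_isTree (n : ℕ) : (pathGraph (n + 1)).IsTree := by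
  refine ⟨pathGraph_connected n, isAcyclic_iff_forall_adj_isBridge.2 fun u v huv => ?_⟩
  wlog hlt : (u : ℕ) + 1 = v generalizing u v
  · rw [Sym2.eq_swap]
    refine this v u huv.symm ?_
    rw [pathGraph_adj] at huv
    omega
  rw [isBridge_iff]
  rintro ⟨p⟩
  -- Without the edge from `u` to `u + 1` no walk leaves the initial segment up to `u`, so every
  -- edge is a bridge.
  have hclosed : ∀ {a b : Fin (n + 1)},
      ((pathGraph (n + 1)).deleteEdges {s(u, v)}).Walk a b → a ≤ u → b ≤ u := by
    intro a b q
    induction q with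
    | nil => exact id
    | @cons a b c h q ih =>
      intro hau
      refine ih ?_
      rw [deleteEdges_adj, pathGraph_adj] at h
      rw [Fin.le_def] at hau ⊢
      by_contra hb
      refine h.2 ?_
      rw [Set.mem_singleton_iff, show a = u from Fin.ext (by omega),
        show b = v from Fin.ext (by omega)]
  have := Fin.le_def.1 (hclosed p le_rfl)
  omega

end SimpleGraph

theorem treewidth_le_of_path {V : Type} {G : SimpleGraph V} {n w : ℕ} (X : ℕ → Finset V)
    (hcover : ∀ v, ∃ i ≤ n, v ∈ X i) (hedge : ∀ u v, G.Adj u v → ∃ i ≤ n, u ∈ X i ∧ v ∈ X i)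
    (hinterval : ∀ x y z, x ≤ y → y ≤ z → ∀ v ∈ X x, v ∈ X z → v ∈ X y)
    (hcard : ∀ i, (X i).card ≤ w + 1) : treewidth G ≤ w := by
  refine Nat.sInf_le ⟨Fin (n + 1), inferInstance, SimpleGraph.pathGraph (n + 1), fun i => X i,
    ⟨SimpleGraph.pathGraph_isTree n, fun v => ?_, fun u v h => ?_, fun x y z p hp hz v hx hy => ?_⟩,
    fun i => hcard i⟩
  · obtain ⟨i, hi, hv⟩ := hcover v
    exact ⟨⟨i, by omega⟩, hv⟩
  · obtain ⟨i, hi, hv⟩ := hedge u v h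
    exact ⟨⟨i, by omega⟩, hv⟩
  · rcases SimpleGraph.pathGraph_isPath_between hp hz with h | h
    · exact hinterval x z y h.1 h.2 v hx hy
    · exact hinterval y z x h.1 h.2 v hy hx

section

variable {m k N : ℕ}

/-- The vertex `v` is in the `i`-th bag of the path decomposition given by the order `σ` of the
path-nodes: the bags consist of a path-node and its neighbours, or of a single isolated vertex. -/
def MemSweepBag (f : Fin m → Fin k → Fin N) (σ : Equiv.Perm (Fin m)) (i : ℕ) :
    AuxVertex m k N → Prop
  | .inl j => (σ.symm j : ℕ) = i
  | .inr a => (∃ j, (σ.symm j : ℕ) = i ∧ f j a.1 = a.2) ∨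
      (∀ j, f j a.1 ≠ a.2) ∧ m + (finProdFinEquiv a : ℕ) = i

open Classical in
-- Positions below `m` hold a path-node and its neighbours, later ones at most one isolated
-- node-node, so the two kinds of bag do not mix.
theorem card_sweepBag_le (f : Fin m → Fin k → Fin N) (σ : Equiv.Perm (Fin m)) (i : ℕ) :
    (Finset.univ.filter (MemSweepBag f σ i)).card ≤ k + 1 := by
  by_cases hi : i < m
  · refine (Finset.card_le_card (t := insert (.inl (σ ⟨i, hi⟩))
      (Finset.univ.image fun l => .inr (l, f (σ ⟨i, hi⟩) l))) ?_).trans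
      ((Finset.card_insert_le _ _).trans ?_)
    · have hσ : ∀ j, (σ.symm j : ℕ) = i → j = σ ⟨i, hi⟩ := fun j hj => by
        rw [← σ.symm_apply_eq]
        exact Fin.ext hj
      rintro (j | ⟨l, b⟩) hv
      · rw [hσ j (Finset.mem_filter.1 hv).2]
        exact Finset.mem_insert_self _ _
      · rcases (Finset.mem_filter.1 hv).2 with ⟨j, hj, hjl⟩ | ⟨-, h⟩
        · refine Finset.mem_insert_of_mem (Finset.mem_image.2 ⟨l, Finset.mem_univ _, ?_⟩)
          rw [← hσ j hj]
          exact congrArg (fun x => Sum.inr (l, x)) hjl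
        · omega
    · have := Finset.card_image_le (s := Finset.univ)
        (f := fun l => (.inr (l, f (σ ⟨i, hi⟩) l) : AuxVertex m k N))
      simpa using this
  · refine (Finset.card_le_one.2 ?_).trans (Nat.le_add_left 1 k)
    have key : ∀ v, MemSweepBag f σ i v → ∃ a : Fin k × Fin N, v = .inr a ∧
        m + (finProdFinEquiv a : ℕ) = i := by
      rintro (j | a) hv
      · have : (σ.symm j : ℕ) = i := hv
        omega
      · rcases hv with ⟨j, hj, -⟩ | ⟨-, h⟩
        · omega
        · exact ⟨a, rfl, h⟩
    intro u hu v hv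
    obtain ⟨a, rfl, ha⟩ := key u (Finset.mem_filter.1 hu).2
    obtain ⟨b, rfl, hb⟩ := key v (Finset.mem_filter.1 hv).2
    rw [finProdFinEquiv.injective (Fin.ext (by omega) : finProdFinEquiv a = finProdFinEquiv b)]

theorem treewidth_auxGraph_le {f : Fin m → Fin k → Fin N} {z : Fin m → ℝ}
    (hz : IsConsecutive z f) : treewidth (auxGraph f) ≤ k := by
  classical
  have hmono : Monotone (z ∘ Tuple.sort z) := Tuple.monotone_sort z
  set σ := Tuple.sort z
  have hle : ∀ p q, (σ.symm p : ℕ) ≤ σ.symm q → z p ≤ z q := fun p q h => by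
    simpa using hmono (Fin.le_def.2 h)
  refine treewidth_le_of_path (n := m + k * N) (fun i => Finset.univ.filter (MemSweepBag f σ i))
    (fun v => ?_) (fun u v huv => ?_) (fun x y w hxy hyw v hx hw => ?_) (card_sweepBag_le f σ)
  · simp only [Finset.mem_filter, Finset.mem_univ, true_and]
    rcases v with j | a
    · exact ⟨σ.symm j, by omega, rfl⟩
    · by_cases h : ∃ j, f j a.1 = a.2
      · obtain ⟨j, hj⟩ := h
        exact ⟨σ.symm j, by omega, .inl ⟨j, rfl, hj⟩⟩
      · exact ⟨m + (finProdFinEquiv a : ℕ), by omega, .inr ⟨by simpa using h, rfl⟩⟩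
  · simp only [Finset.mem_filter, Finset.mem_univ, true_and]
    rcases u with j | a <;> rcases v with i | b
    · exact huv.elim
    · exact ⟨σ.symm j, by omega, rfl, .inl ⟨j, rfl, huv⟩⟩
    · exact ⟨σ.symm i, by omega, .inl ⟨i, rfl, huv⟩, rfl⟩
    · exact huv.elim
  · simp only [Finset.mem_filter, Finset.mem_univ, true_and] at hx hw ⊢
    rcases v with j | a
    · have h1 : (σ.symm j : ℕ) = x := hx
      have h2 : (σ.symm j : ℕ) = w := hw
      exact show (σ.symm j : ℕ) = y by omega
    · rcases hx with ⟨p, hp, hpa⟩ | ⟨hx, hxa⟩ <;> rcases hw with ⟨r, hr, hra⟩ | ⟨hw, hwa⟩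
      · have hy : y < m := by omega
        refine .inl ⟨σ ⟨y, hy⟩, by simp, ?_⟩
        rw [← hpa]
        -- The path-node at position `y` lies between two path-nodes joined to `a`, hence is joined
        -- to `a` as well.
        refine hz a.1 p _ r (hle _ _ ?_) (hle _ _ ?_) (hpa.trans hra.symm) <;> simp <;> omega
      · exact absurd hpa (hw p)
      · exact absurd hra (hx r)
      · exact .inr ⟨hx, by omega⟩

end

/-! ### Almost surely there are no ties -/

theorem ae_apply_coe_ne {ι : Type} [Fintype ι] (i : ι) (c : ℝ) :
    ∀ᵐ x : ι → unitInterval, (x i : ℝ) ≠ c := by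
  by_cases hc : c ∈ unitInterval
  · have h : (volume : Measure (ι → unitInterval)) {x | x i = ⟨c, hc⟩} = 0 :=
      Measure.pi_hyperplane (fun _ : ι => (volume : Measure unitInterval)) i ⟨c, hc⟩
    filter_upwards [measure_eq_zero_iff_ae_notMem.1 h] with x hx hxc
    exact hx (Subtype.ext hxc)
  · exact ae_of_all _ fun x hx => hc (hx ▸ (x i).2)

/-- Two coordinates are independent, so their joint law is the product measure, for which the
diagonal is null. -/
theorem ae_apply_ne_apply {ι : Type} [Fintype ι] {i j : ι} (hij : i ≠ j) :
    ∀ᵐ x : ι → unitInterval, x i ≠ x j := by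
  have hi := measurePreserving_eval (fun _ : ι => (volume : Measure unitInterval)) i
  have hj := measurePreserving_eval (fun _ : ι => (volume : Measure unitInterval)) j
  have hind : ProbabilityTheory.IndepFun (fun x : ι → unitInterval => x i) (fun x => x j)
      (Measure.pi fun _ => volume) :=
    (ProbabilityTheory.iIndepFun_pi (X := fun _ => id) fun _ => aemeasurable_id).indepFun hij
  rw [ProbabilityTheory.indepFun_iff_map_prod_eq_prod_map_map hi.measurable.aemeasurable
    hj.measurable.aemeasurable] at hind
  have hmap : Measure.map (fun x : ι → unitInterval => (x i, x j)) (Measure.pi fun _ => volume) =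
      (volume : Measure unitInterval).prod volume := by
    rw [hind]
    congr 1
    · exact hi.map_eq
    · exact hj.map_eq
  have hmeas : Measurable fun x : ι → unitInterval => (x i, x j) :=
    hi.measurable.prodMk hj.measurable
  have hdiag : MeasurableSet {p : unitInterval × unitInterval | p.1 = p.2} :=
    measurableSet_eq_fun measurable_fst measurable_snd
  have h0 : ((volume : Measure unitInterval).prod volume) {p | p.1 = p.2} = 0 := by
    rw [Measure.measure_prod_null hdiag]
    refine ae_of_all _ fun x => ?_
    have : Prod.mk x ⁻¹' {p : unitInterval × unitInterval | p.1 = p.2} = {x} := by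
      ext y
      simp [eq_comm]
    simp [this]
  rw [← hmap, Measure.map_apply hmeas hdiag] at h0
  exact measure_eq_zero_iff_ae_notMem.1 h0

/-- No path point is equidistant from two points of the same tier. -/
def NoTies {m k N : ℕ} (s : (Fin m → unitInterval) × (Fin k → Fin N → unitInterval)) : Prop :=
  ∀ j l i i', i ≠ i' → |(s.1 j : ℝ) - s.2 l i| ≠ |(s.1 j : ℝ) - s.2 l i'|

/-- A tie means that two points of the tier coincide or that the path point is their midpoint; the
latter is null by Fubini, with the tier points fixed. -/
theorem ae_noTies (m k N : ℕ) :
    ∀ᵐ s : (Fin m → unitInterval) × (Fin k → Fin N → unitInterval), NoTies s := by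
  simp only [NoTies, ae_all_iff]
  intro j l i i' hi
  have h1 : ∀ᵐ s : (Fin m → unitInterval) × (Fin k → Fin N → unitInterval),
      s.2 l i ≠ s.2 l i' := by
    have hl := (measurePreserving_eval
      (fun _ : Fin k => (volume : Measure (Fin N → unitInterval))) l).quasiMeasurePreserving
    exact Measure.quasiMeasurePreserving_snd.ae (hl.ae (ae_apply_ne_apply hi))
  have h2 : ∀ᵐ s : (Fin m → unitInterval) × (Fin k → Fin N → unitInterval),
      (s.1 j : ℝ) ≠ ((s.2 l i : ℝ) + s.2 l i') / 2 := by
    have hS : MeasurableSet {s : (Fin m → unitInterval) × (Fin k → Fin N → unitInterval) |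
        (s.1 j : ℝ) = ((s.2 l i : ℝ) + s.2 l i') / 2} :=
      measurableSet_eq_fun (by fun_prop) (by fun_prop)
    refine measure_eq_zero_iff_ae_notMem.1 ((Measure.prod_apply_symm hS).trans ?_)
    refine (lintegral_congr fun y => ?_).trans lintegral_zero
    exact measure_eq_zero_iff_ae_notMem.2 (ae_apply_coe_ne j (((y l i : ℝ) + y l i') / 2))
  filter_upwards [h1, h2] with s h1 h2 h
  rcases abs_eq_abs.1 h with h | h
  · exact h1 (Subtype.ext (by linarith))
  · exact h2 (by linarith)

/-- Let `a` be the point closest to `p` and `r`, and `b` the one closest to `q`. The difference of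
squared distances `(x - a)² - (x - b)²` is affine in `x`, at most 0 at `p` and `r`, and, if `a` and
`b` had different indices, positive at `q` between them. -/
theorem IsClosest.isConsecutive {m k N : ℕ}
    {s : (Fin m → unitInterval) × (Fin k → Fin N → unitInterval)} {f : Fin m → Fin k → Fin N}
    (hf : IsClosest s.1 s.2 f) (hs : NoTies s) : IsConsecutive (fun j => (s.1 j : ℝ)) f := by
  intro l p q r hpq hqr hpr
  by_contra hne
  have h1 := sq_le_sq.2 (hf p l (f q l))
  have h2 := sq_lt_sq.2 (lt_of_le_of_ne (hf q l (f p l)) (hs q l _ _ hne))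
  have h3 := sq_le_sq.2 (hf r l (f q l))
  rw [← hpr] at h3
  simp only at hpq hqr
  rcases le_total (s.2 l (f p l) : ℝ) (s.2 l (f q l)) with h | h
  · nlinarith [mul_nonneg (sub_nonneg.2 h) (sub_nonneg.2 hqr)]
  · nlinarith [mul_nonneg (sub_nonneg.2 h) (sub_nonneg.2 hpq)]

/-- For large `N` the probability is exactly 1. Almost sure equality with the whole space suffices,
so the event need not be shown measurable. -/
theorem whp_of_eventually {k : ℕ} {m : ℕ → ℕ} {P : ∀ N, (Fin (m N) → Fin k → Fin N) → Prop}
    (h : ∀ᶠ N in atTop, ∀ (z : Fin (m N) → ℝ) (f : Fin (m N) → Fin k → Fin N),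
      IsConsecutive z f → P N f) : Whp k m P := by
  refine tendsto_const_nhds.congr' ?_
  filter_upwards [h] with N hN
  have : ∀ᵐ s : (Fin (m N) → unitInterval) × (Fin k → Fin N → unitInterval),
      s ∈ {s | ∀ f, IsClosest s.1 s.2 f → P N f} := by
    filter_upwards [ae_noTies (m N) k N] with s hs f hf
    exact hN _ f (hf.isConsecutive hs)
  exact ((measure_congr (eventuallyEq_univ.2 this)).trans measure_univ).symm

/-! ### Asymptotics -/

theorem tendsto_natCast_mul_atTop {k : ℕ} (hk : 1 ≤ k) :
    Tendsto (fun N : ℕ => ((k * N : ℕ) : ℝ)) atTop atTop :=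
  tendsto_natCast_atTop_atTop.comp (tendsto_id.const_mul_atTop' hk)

theorem eventually_pos_of_tendsto_div {k : ℕ} {m : ℕ → ℕ}
    (hm : Tendsto (fun N : ℕ => (m N : ℝ) / ((k * N : ℕ) : ℝ)) atTop atTop) :
    ∀ᶠ N in atTop, 0 < m N := by
  filter_upwards [hm.eventually_gt_atTop 0] with N hN
  by_contra h
  simp [Nat.eq_zero_of_not_pos h] at hN

/-- If `m ≤ n ^ 2`, then the running time is polynomial in `n`. -/
theorem exists_time_solve_le {k : ℕ} (hk : 1 ≤ k) {m : ℕ → ℕ}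
    (hm : Tendsto (fun N : ℕ => (m N : ℝ) / ((k * N : ℕ) : ℝ)) atTop atTop)
    (hm2 : (fun N : ℕ => (m N : ℝ)) =o[atTop] fun N : ℕ => ((k * N : ℕ) : ℝ) ^ 2) (M : ℕ) :
    ∃ C : ℝ, Whp k m fun N f => ∀ c W, (∀ a, c a ≤ M) →
      ((auxNet f c W).solve.time : ℝ) ≤ (2 : ℝ) ^ (C * Real.log ((k * N : ℕ) : ℝ)) := by
  have hn := tendsto_natCast_mul_atTop hk
  set E := 40 * (k + 1) + 500
  -- The base of the running time is at most `n ^ 3`; dividing by `log 2` turns `n ^ (3 * E)` into a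
  -- power of 2.
  refine ⟨(3 * E : ℕ) / Real.log 2, whp_of_eventually ?_⟩
  filter_upwards [eventually_pos_of_tendsto_div hm, hm2.bound zero_lt_one,
    hn.eventually_ge_atTop ((M + k + 9 : ℕ) : ℝ)] with N hpos hle hN z f hz c W hc
  have hN' : M + k + 9 ≤ k * N := by exact_mod_cast hN
  have hle' : m N ≤ (k * N) ^ 2 := by
    rw [Real.norm_of_nonneg (by positivity), Real.norm_of_nonneg (by positivity), one_mul] at hle
    exact_mod_cast hle
  have hQ : m N + k * N + (M + k + 9) ≤ (k * N) ^ 3 := by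
    have : 3 * (k * N) ^ 2 ≤ (k * N) ^ 3 := by
      rw [pow_succ (k * N) 2, mul_comm]
      exact Nat.mul_le_mul_left _ (by omega)
    nlinarith
  have htime : (auxNet f c W).solve.time ≤ (k * N) ^ (3 * E) := by
    rw [pow_mul]
    exact (time_solve_auxNet_le hz hpos hc).trans (Nat.pow_le_pow_left hQ _)
  have hnpos : (0 : ℝ) < ((k * N : ℕ) : ℝ) := by
    exact_mod_cast (by omega : 0 < k * N)
  have hlog2 : Real.log 2 ≠ 0 := (Real.log_pos one_lt_two).ne'
  have hpow : (2 : ℝ) ^ ((3 * E : ℕ) / Real.log 2 * Real.log ((k * N : ℕ) : ℝ)) =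
      ((k * N : ℕ) : ℝ) ^ (3 * E) := by
    rw [Real.rpow_def_of_pos two_pos, ← Real.rpow_natCast, Real.rpow_def_of_pos hnpos]
    congr 1
    field_simp
  rw [hpow]
  exact_mod_cast htime

theorem theorem4 (k : ℕ) (hk : 1 ≤ k) (m : ℕ → ℕ)
    (hm : Tendsto (fun N : ℕ => (m N : ℝ) / ((k * N : ℕ) : ℝ)) atTop atTop) :
    (∃ δ : ℕ → ℝ, Tendsto δ atTop (𝓝 0) ∧
      Whp k m fun N f =>
        (treewidth (auxGraph f) : ℝ) ≤
          k * ((m N : ℝ) / ((k * N : ℕ) : ℝ)) * Real.log ((k * N : ℕ) : ℝ) * (1 + δ N)) ∧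
    (((fun N : ℕ => (m N : ℝ)) =o[atTop] fun N : ℕ => ((k * N : ℕ) : ℝ) ^ 2) →
      ∀ M : ℕ, ∃ g : ℕ → ℝ, (g =o[atTop] fun N : ℕ => ((k * N : ℕ) : ℝ)) ∧
        Whp k m fun N f => ∀ c W, (∀ a, c a ≤ M) →
          ((auxNet f c W).solve.time : ℝ) ≤ (2 : ℝ) ^ g N) ∧
    ((∀ ε : ℝ, 0 < ε →
        (fun N : ℕ => (m N : ℝ)) =o[atTop] fun N : ℕ => ((k * N : ℕ) : ℝ) ^ (1 + ε)) →
      ∀ M : ℕ, ∃ (C : ℝ) (d : ℕ),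
        Whp k m fun N f => ∀ c W, (∀ a, c a ≤ M) →
          ((auxNet f c W).solve.time : ℝ) ≤
            (2 : ℝ) ^ (C * Real.log ((k * N : ℕ) : ℝ) ^ d)) := by
  have hn := tendsto_natCast_mul_atTop hk
  -- `δ = 0` works: the treewidth is at most `k`, while eventually `m / n ≥ 1` and `log n ≥ 1`.
  refine ⟨⟨fun _ => 0, tendsto_const_nhds, whp_of_eventually ?_⟩, fun hm2 M => ?_, fun hε M => ?_⟩
  · filter_upwards [hm.eventually_ge_atTop 1, hn.eventually_ge_atTop (Real.exp 1)]
      with N hmN hN z f hz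
    have hlog : 1 ≤ Real.log ((k * N : ℕ) : ℝ) :=
      (Real.le_log_iff_exp_le ((Real.exp_pos 1).trans_le hN)).2 hN
    have htw : (treewidth (auxGraph f) : ℝ) ≤ k := by exact_mod_cast treewidth_auxGraph_le hz
    have hk0 : (0 : ℝ) ≤ k := k.cast_nonneg
    calc (treewidth (auxGraph f) : ℝ) ≤ k := htw
      _ ≤ k * ((m N : ℝ) / ((k * N : ℕ) : ℝ)) := le_mul_of_one_le_right hk0 hmN
      _ ≤ k * ((m N : ℝ) / ((k * N : ℕ) : ℝ)) * Real.log ((k * N : ℕ) : ℝ) :=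
        le_mul_of_one_le_right (mul_nonneg hk0 (zero_le_one.trans hmN)) hlog
      _ = _ := by ring
  · obtain ⟨C, hC⟩ := exists_time_solve_le hk hm hm2 M
    -- Here `g = C log n`, which is `o(n)`.
    exact ⟨_, (Real.isLittleO_log_id_atTop.comp_tendsto hn).const_mul_left C, hC⟩
  -- Taking `ε = 1` reduces to `m = o(n²)`; the bound is then polynomial, so `d = 1`.
  · have hm2 : (fun N : ℕ => (m N : ℝ)) =o[atTop] fun N : ℕ => ((k * N : ℕ) : ℝ) ^ 2 := by
      refine (hε 1 one_pos).congr_right fun N => ?_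
      rw [show (1 : ℝ) + 1 = (2 : ℕ) by norm_num, Real.rpow_natCast]
    obtain ⟨C, hC⟩ := exists_time_solve_le hk hm hm2 M
    exact ⟨C, 1, by simpa only [pow_one] using hC⟩
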